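/- Let $\triangle$ be the triangular grid: its vertices are the projections $\varphi(p)$ of the points $p\in\mathbb{Z}^3$ along $(1,1,1)$, and its positively oriented edges are $u\to u+\varphi(e_i)$, where $e_1,e_2,e_3$ are the unit vectors. The height of $p=(x,y,z)$ is $x+y+z$. A lozenge is the union of two triangles of the grid that share an edge; it overlaps that edge, and the direction of that edge is its orientation. Let $R$ be a region, that is, a (finite or infinite) subcomplex of $\triangle$ whose underlying set in the plane is simply connected, with sets of vertices, edges and triangles $R^0,R^1,R^2$, and let $\partial R$ be the set of edges of $R$ that do not have triangles of $R$ on both sides. Let $X_1,X_2$ be sets of edges of $\triangle$. A solution of Tiling$(R,X_1,X_2)$ is a set of lozenges contained in $R$ that cover every triangle of $R$ exactly once, such that no edge of $X_1\cup X_2$ is overlapped and the two lozenges adjacent to an edge of $X_2$ have different orientations. The weighted directed graph $DC(R,X_1,X_2)$ has vertex set $R^0$ and the following edges: $u\to v$ of weight $1$ for every positively oriented edge $u\to v$ of $R$; $v\to u$ of weight $-1$ for every positively oriented edge $u\to v$ of $R$ that belongs to $\partial R\cup X_1\cup X_2$; and $w\to w'$ and $w'\to w$ of weight $0$ for every edge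 $uv\in X_2$ such that both triangles $uvw$ and $uvw'$ adjacent to it belong to $R$. A function $h:R^0\to\mathbb{Z}$ satisfies the difference constraints if $h(v)-h(u)\le w$ for every edge $u\to v$ of weight $w$. It is a height function if, up to a global additive constant, $h(v)$ is for every $v\in R^0$ the height of a point of $\mathbb{Z}^3$ that projects to $v$. Then the solutions of Tiling$(R,X_1,X_2)$ correspond one-to-one to the integer-valued height functions $h:R^0\to\mathbb{Z}$ that satisfy the difference constraints of $DC(R,X_1,X_2)$, taken up to an additive constant. The tiling is recovered from $h$ by linking adjacent vertices whose values differ by $1$: an edge of $R$ is not overlapped by a lozenge of the tiling exactly when the values of $h$ at its two ends differ by $1$. Moreover, Tiling$(R,X_1,X_2)$ has a solution if and only if some function $h:R^0\to\mathbb{Z}$ (height function or not) satisfies the difference constraints. -/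

import Mathlib

namespace LozengeTiling

/-! ### The triangular grid -/

/-- A vertex of the triangular grid. The plane is `ℝ³ / ℝ(1,1,1)`, coordinatized by `ℝ × ℝ` through
`(x, y, z) ↦ (x - z, y - z)`; the vertices are the images of the points of `ℤ³`. -/
abbrev Vertex : Type := ℤ × ℤ

/-- The projection `φ` along `(1,1,1)`, on the vertices of the cubic grid. -/
def proj (p : Fin 3 → ℤ) : Vertex := (p 0 - p 2, p 1 - p 2)

/-- The height `x + y + z` of a vertex of the cubic grid. -/
def height (p : Fin 3 → ℤ) : ℤ := p 0 + p 1 + p 2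

/-- The three positive directions `φ(1,0,0)`, `φ(0,1,0)`, `φ(0,0,1)`. -/
def dir (k : Fin 3) : Vertex := proj (Pi.single k 1)

/-- `u → v` is a positively oriented edge of the triangular grid. -/
def IsPositive (u v : Vertex) : Prop := ∃ k : Fin 3, v = u + dir k

/-- The triangular grid, as a graph. -/
def grid : SimpleGraph Vertex := SimpleGraph.fromRel IsPositive

/-- The edges of the triangular grid, each as the set of its two ends. -/
def gridEdges : Set (Finset Vertex) := {e | ∃ u v, grid.Adj u v ∧ e = {u, v}}

/-! ### Regions -/

/-- A region: a subcomplex of the triangular grid, where a simplex is given by its set of vertices.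
The simplices of the grid (vertices, edges and triangles) are the nonempty sets of pairwise adjacent
vertices. It may be finite or infinite. -/
structure Region extends PreAbstractSimplicialComplex Vertex where
  isClique_of_mem : ∀ s ∈ faces, grid.IsClique (s : Set Vertex)

namespace Region

variable (R : Region)

/-- `R⁰` -/
def vertices : Set Vertex := {v | {v} ∈ R.faces}

/-- `R¹` -/
def edges : Set (Finset Vertex) := {e | e ∈ R.faces ∧ e.card = 2}

/-- `R²` -/
def triangles : Set (Finset Vertex) := {t | t ∈ R.faces ∧ t.card = 3}

/-- The part of the plane covered by the region: the union of its (closed) simplices. -/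
def carrier : Set (ℝ × ℝ) :=
  ⋃ s ∈ R.faces, convexHull ℝ ((fun v : Vertex ↦ ((v.1 : ℝ), (v.2 : ℝ))) '' (s : Set Vertex))

/-- The boundary edges `∂R`: the edges of `R` that do not have a triangle of `R` on both sides. -/
def boundary : Set (Finset Vertex) :=
  {e | e ∈ R.edges ∧ ¬ ∃ t ∈ R.triangles, ∃ t' ∈ R.triangles, t ≠ t' ∧ e ⊆ t ∧ e ⊆ t'}

end Region

/-! ### Lozenges and tilings -/

/-- A lozenge: the projection of the square face of the cubic grid with corners
`p`, `p + eᵢ`, `p + eⱼ`, `p + eᵢ + eⱼ`, where `i`, `j` are the two indices other than `normal` and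
`base = φ(p)`. Its orientation is `normal`. -/
@[ext]
structure Lozenge where
  base : Vertex
  normal : Fin 3

namespace Lozenge

variable (l : Lozenge)

/-- The second corner of the lozenge. -/
def left : Vertex := l.base + dir (l.normal + 1)

/-- The third corner of the lozenge. -/
def right : Vertex := l.base + dir (l.normal + 2)

/-- The corner of the lozenge opposite to the base. -/
def top : Vertex := l.base + dir (l.normal + 1) + dir (l.normal + 2)

/-- The edge of the triangular grid that the lozenge overlaps, that is, its short diagonal. -/
def overlapped : Finset Vertex := {l.base, l.top}

/-- The two triangles of the grid that make up the lozenge. -/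
def triangles : Set (Finset Vertex) := {{l.base, l.left, l.top}, {l.base, l.right, l.top}}

/-- The four sides of the lozenge. -/
def sides : Set (Finset Vertex) :=
  {{l.base, l.left}, {l.left, l.top}, {l.base, l.right}, {l.right, l.top}}

end Lozenge

/-- `T` is a lozenge tiling of `R`: the lozenges of `T` lie in `R`, and every triangle of `R` is
covered by exactly one of them. -/
def IsTiling (R : Region) (T : Set Lozenge) : Prop :=
  (∀ l ∈ T, l.triangles ⊆ R.triangles) ∧ ∀ t ∈ R.triangles, ∃! l, l ∈ T ∧ t ∈ l.triangles

/-- `T` is a solution of the tiling problem `Tiling(R, X₁, X₂)`: no edge of `X₁ ∪ X₂` is overlapped,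
and the two lozenges adjacent to an edge of `X₂` have different orientations. -/
def IsSolution (R : Region) (X₁ X₂ : Set (Finset Vertex)) (T : Set Lozenge) : Prop :=
  IsTiling R T ∧
  (∀ e ∈ X₁ ∪ X₂, ∀ l ∈ T, l.overlapped ≠ e) ∧
  (∀ e ∈ X₂, ∀ l ∈ T, ∀ l' ∈ T, l ≠ l' → e ∈ l.sides → e ∈ l'.sides → l.normal ≠ l'.normal)

/-! ### The weighted graph of difference constraints -/

/-- The weighted directed graph `DC(R, X₁, X₂)` on `R⁰`; `DC R X₁ X₂ u v w` says that there is an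
edge `u → v` of weight `w`. Edges of `X₁ ∪ X₂` act where they belong to `R`, and the lateral edges of
an edge of `X₂` are present when the triangles on both of its sides belong to `R`. -/
inductive DC (R : Region) (X₁ X₂ : Set (Finset Vertex)) : R.vertices → R.vertices → ℤ → Prop
  | positive (u v : R.vertices) : IsPositive u v → {u.1, v.1} ∈ R.edges → DC R X₁ X₂ u v 1
  | negative (u v : R.vertices) : IsPositive v u → {u.1, v.1} ∈ R.edges →
      {u.1, v.1} ∈ R.boundary ∪ X₁ ∪ X₂ → DC R X₁ X₂ u v (-1)
  | lateral (u v : Vertex) (a b : R.vertices) : {u, v} ∈ X₂ → a ≠ b →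
      {u, v, a.1} ∈ R.triangles → {u, v, b.1} ∈ R.triangles → DC R X₁ X₂ a b 0

/-- `h` satisfies the system of difference constraints induced by `DC(R, X₁, X₂)`. -/
def SatisfiesDC (R : Region) (X₁ X₂ : Set (Finset Vertex)) (h : R.vertices → ℤ) : Prop :=
  ∀ u v w, DC R X₁ X₂ u v w → h v - h u ≤ w

/-- `h` is a height assignment: up to a global additive constant, the value at each vertex `v` of `R`
is the height of a vertex of the cubic grid that projects to `v`. -/
def IsHeight (R : Region) (h : R.vertices → ℤ) : Prop :=
  ∃ c : ℤ, ∀ v : R.vertices, ∃ p : Fin 3 → ℤ, proj p = v ∧ h v = height p + c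

/-- The integer-valued height functions that satisfy the difference constraints. -/
def HeightSolution (R : Region) (X₁ X₂ : Set (Finset Vertex)) : Type :=
  {h : R.vertices → ℤ // IsHeight R h ∧ SatisfiesDC R X₁ X₂ h}

/-- Equality up to an additive constant. -/
instance heightSetoid (R : Region) (X₁ X₂ : Set (Finset Vertex)) :
    Setoid (HeightSolution R X₁ X₂) where
  r h h' := ∃ c : ℤ, ∀ v, h'.1 v = h.1 v + c
  iseqv :=
    { refl := fun _ ↦ ⟨0, fun _ ↦ (add_zero _).symm⟩
      symm := fun ⟨c, hc⟩ ↦ ⟨-c, fun v ↦ by rw [hc v]; ring⟩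
      trans := fun ⟨c, hc⟩ ⟨d, hd⟩ ↦ ⟨c + d, fun v ↦ by rw [hd v, hc v]; ring⟩ }

/-- The edges of `R` that link adjacent vertices whose values differ by `1`. -/
def linkedEdges (R : Region) (h : R.vertices → ℤ) : Set (Finset Vertex) :=
  {e | e ∈ R.edges ∧ ∃ u v : R.vertices, e = {u.1, v.1} ∧ |h u - h v| = 1}

/-- The picture of a tiling: the edges of `R` that no lozenge overlaps. An edge of a triangle of `R`
is of this kind exactly when it is a side of a lozenge of the tiling. -/
def drawnEdges (R : Region) (T : Set Lozenge) : Set (Finset Vertex) :=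
  {e | e ∈ R.edges ∧ ∀ l ∈ T, l.overlapped ≠ e}

end LozengeTiling

namespace LozengeTiling

/-! Heights of lifts of `v` form one residue class mod 3, that of `v.1 + v.2`. So a height function
changes along a positive edge by a number congruent to 1 mod 3, and the constraint of weight 1
leaves 1, -2, -5, ... Around a triangle the three increments sum to zero, so exactly one is -2 and
the others are 1. The edges with increment -2 (the jumps) pair the triangles into lozenges; the
weights -1 keep jumps off `∂R ∪ X₁ ∪ X₂`, and the weights 0 force different orientations across `X₂`
(`IsJumpFunction.isSolution`).

Conversely, put -2 on the edges overlapped by a tiling and 1 on the other positive edges. The sum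
around every triangle is zero, so this is a 1-cocycle on `R`, and simple connectedness makes it a
coboundary (`Region.exists_potential`). That lemma is proved topologically: the cocycle is
interpolated linearly on each simplex, the pieces agree mod 1 and glue to a circle-valued map on
`R.carrier`, and this map lifts to ℝ. A tiling determines all the increments, so by connectedness
its height function is unique up to a constant (`IsJumpFunction.eq_add_const`).

Finally, every weight is congruent mod 3 to the difference of the residues at its ends. Rounding an
arbitrary solution down to these residues therefore preserves the constraints and yields a height
function (`SatisfiesDC.roundDown`). -/

open unitInterval

/-! ### Barycentric coordinates on the grid and continuous functions on a region -/

/-- The position of a vertex in the real plane. -/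
def realPoint (v : Vertex) : ℝ × ℝ := ((v.1 : ℝ), (v.2 : ℝ))

/-- The piecewise linear function on the plane that is `1` at `v` and `0` at the other vertices. -/
noncomputable def hat (v : Vertex) (x : ℝ × ℝ) : ℝ :=
  -- The inner maximum is the distance to `v` in the norm whose unit ball is the hexagon of the six
  -- grid triangles around the origin.
  max 0 (1 - max |x.1 - v.1| (max |x.2 - v.2| |(x.1 - x.2) - (v.1 - v.2)|))

lemma continuous_hat (v : Vertex) : Continuous (hat v) := by
  unfold hat; fun_prop

/-- The values of a hat function on the triangle `a`, `a + (1, 0)`, `a + (1, 1)`. -/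
lemma hat_lower (a v : Vertex) {p q r : ℝ} (hp : 0 ≤ p) (hq : 0 ≤ q) (hr : 0 ≤ r)
    (h : p + q + r = 1) : hat v (a.1 + q + r, a.2 + r) =
      if v = a then p else if v = a + (1, 0) then q else if v = a + (1, 1) then r else 0 := by
  obtain ⟨a1, a2⟩ := a
  obtain ⟨v1, v2⟩ := v
  obtain ⟨m, rfl⟩ : ∃ m, a1 = v1 + m := ⟨a1 - v1, by ring⟩
  obtain ⟨n, rfl⟩ : ∃ n, a2 = v2 + n := ⟨a2 - v2, by ring⟩
  have key : hat (v1, v2) (((v1 + m : ℤ) : ℝ) + q + r, ((v2 + n : ℤ) : ℝ) + r) =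
      max 0 (1 - max |(m : ℝ) + q + r| (max |(n : ℝ) + r| |(m : ℝ) - n + q|)) := by
    unfold hat; push_cast; ring_nf
  rw [key]
  have zero : ∀ {y : ℝ}, 1 ≤ y → max 0 (1 - y) = 0 := fun hy ↦ max_eq_left (by linarith)
  -- Unless `m` and `n` are both in `{-1, 0}`, one coordinate of the point is at distance at least 1
  -- from that of `v`, and the hat vanishes.
  rcases (by omega : m ≤ -2 ∨ 1 ≤ m ∨ m = 0 ∨ m = -1) with hm | hm | rfl | rfl
  · have : (m : ℝ) ≤ -2 := by exact_mod_cast hm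
    rw [zero (le_max_of_le_left (by rw [le_abs]; right; linarith))]
    simp only [Prod.mk.injEq, Prod.mk_add_mk]
    rw [if_neg (by omega), if_neg (by omega), if_neg (by omega)]
  · have : (1 : ℝ) ≤ m := by exact_mod_cast hm
    rw [zero (le_max_of_le_left (by rw [le_abs]; left; linarith))]
    simp only [Prod.mk.injEq, Prod.mk_add_mk]
    rw [if_neg (by omega), if_neg (by omega), if_neg (by omega)]
  all_goals
    rcases (by omega : n ≤ -2 ∨ 1 ≤ n ∨ n = 0 ∨ n = -1) with hn | hn | rfl | rfl
    · have : (n : ℝ) ≤ -2 := by exact_mod_cast hn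
      rw [zero (le_max_of_le_right (le_max_of_le_left (by rw [le_abs]; right; linarith)))]
      simp only [Prod.mk.injEq, Prod.mk_add_mk]
      rw [if_neg (by omega), if_neg (by omega), if_neg (by omega)]
    · have : (1 : ℝ) ≤ n := by exact_mod_cast hn
      rw [zero (le_max_of_le_right (le_max_of_le_left (by rw [le_abs]; left; linarith)))]
      simp only [Prod.mk.injEq, Prod.mk_add_mk]
      rw [if_neg (by omega), if_neg (by omega), if_neg (by omega)]
  · push_cast
    rw [abs_of_nonneg (by linarith), abs_of_nonneg (by linarith), abs_of_nonneg (by linarith),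
      max_eq_left (a := (0 : ℝ) + q + r) (max_le (by linarith) (by linarith)),
      max_eq_right (a := (0 : ℝ)) (by linarith)]
    simp; linarith
  · push_cast
    rw [zero (le_max_of_le_right (le_max_of_le_right (by rw [le_abs]; left; linarith)))]
    simp
  · push_cast
    rw [abs_of_nonpos (by linarith : (-1 : ℝ) + q + r ≤ 0), abs_of_nonneg (by linarith),
      abs_of_nonpos (by linarith), max_eq_right (a := (0 : ℝ) + r) (by linarith),
      max_eq_right (a := -((-1 : ℝ) + q + r)) (by linarith),
      max_eq_right (a := (0 : ℝ)) (by linarith)]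
    simp
  · push_cast
    rw [abs_of_nonpos (by linarith : (-1 : ℝ) + q + r ≤ 0), abs_of_nonpos (by linarith),
      abs_of_nonneg (by linarith), max_eq_left (a := -((-1 : ℝ) + r)) (by linarith),
      max_eq_right (a := -((-1 : ℝ) + q + r)) (by linarith),
      max_eq_right (a := (0 : ℝ)) (by linarith)]
    simp

/-- The reflection in the diagonal exchanges the two kinds of grid triangles, so `hat_upper` follows
from `hat_lower`. -/
lemma hat_swap (v : Vertex) (x : ℝ × ℝ) : hat v x = hat v.swap x.swap := by
  unfold hat
  rw [← max_assoc, max_comm |x.1 - v.1|, max_assoc, abs_sub_comm (x.1 - x.2)]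
  simp only [Prod.fst_swap, Prod.snd_swap]
  ring_nf

/-- The values of a hat function on the triangle `a`, `a + (0, 1)`, `a + (1, 1)`. -/
lemma hat_upper (a v : Vertex) {p q r : ℝ} (hp : 0 ≤ p) (hq : 0 ≤ q) (hr : 0 ≤ r)
    (h : p + q + r = 1) : hat v (a.1 + r, a.2 + q + r) =
      if v = a then p else if v = a + (0, 1) then q else if v = a + (1, 1) then r else 0 := by
  rw [hat_swap]
  have := hat_lower a.swap v.swap hp hq hr h
  simp only [Prod.fst_swap, Prod.snd_swap] at this
  simp only [Prod.swap_prod_mk, this]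
  congr 1
  · simp
  · obtain ⟨a1, a2⟩ := a
    obtain ⟨v1, v2⟩ := v
    simp only [Prod.swap_prod_mk, Prod.mk_add_mk, Prod.mk.injEq, and_comm]

lemma grid_adj_iff (u v : Vertex) : grid.Adj u v ↔
    u ≠ v ∧ |v.1 - u.1| ≤ 1 ∧ |v.2 - u.2| ≤ 1 ∧ |(v.1 - v.2) - (u.1 - u.2)| ≤ 1 := by
  obtain ⟨u1, u2⟩ := u
  obtain ⟨v1, v2⟩ := v
  simp only [grid, SimpleGraph.fromRel_adj, IsPositive, Fin.exists_fin_succ, dir, proj,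
    Prod.mk_add_mk, Prod.mk.injEq, ne_eq, abs_le]
  simp [Pi.single_apply]
  omega

/-- A clique of the grid is contained in a triangle of the grid. -/
lemma exists_triangle_of_isClique {s : Finset Vertex} (hne : s.Nonempty)
    (hs : grid.IsClique (s : Set Vertex)) : ∃ a : Vertex, ∃ e : Vertex, (e = (1, 0) ∨ e = (0, 1)) ∧
      s ⊆ {a, a + e, a + (1, 1)} := by
  have hadj : ∀ u ∈ s, ∀ v ∈ s, |v.1 - u.1| ≤ 1 ∧ |v.2 - u.2| ≤ 1 ∧
      |(v.1 - v.2) - (u.1 - u.2)| ≤ 1 := by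
    intro u hu v hv
    by_cases h : u = v
    · simp [h]
    · exact ((grid_adj_iff u v).1 (hs hu hv h)).2
  obtain ⟨x, hx, hx'⟩ := s.exists_min_image Prod.fst hne
  obtain ⟨y, hy, hy'⟩ := s.exists_min_image Prod.snd hne
  simp only [abs_le] at hadj
  -- The clique lies in a unit square with lower corner `(x.1, y.2)`. It cannot contain both ends of
  -- the antidiagonal, which are not adjacent; which one it omits decides the triangle.
  by_cases he : (x.1 + 1, y.2) ∈ s
  · refine ⟨(x.1, y.2), (1, 0), Or.inl rfl, fun z hz ↦ ?_⟩
    have h1 := hadj x hx z hz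
    have h2 := hadj y hy z hz
    have h3 := hadj _ he z hz
    have h4 := hx' z hz
    have h5 := hy' z hz
    obtain ⟨z1, z2⟩ := z
    simp only [Finset.mem_insert, Finset.mem_singleton, Prod.mk_add_mk, Prod.mk.injEq]
    simp only at h1 h2 h3 h4 h5
    omega
  · refine ⟨(x.1, y.2), (0, 1), Or.inr rfl, fun z hz ↦ ?_⟩
    have h1 := hadj x hx z hz
    have h2 := hadj y hy z hz
    have h4 := hx' z hz
    have h5 := hy' z hz
    have h6 : z ≠ (x.1 + 1, y.2) := fun h ↦ he (h ▸ hz)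
    obtain ⟨z1, z2⟩ := z
    simp only [Finset.mem_insert, Finset.mem_singleton, Prod.mk_add_mk, Prod.mk.injEq, ne_eq] at h6 ⊢
    simp only at h1 h2 h4 h5
    omega

/-- The hat functions restrict to the barycentric coordinates on the simplices of the grid. -/
lemma hat_barycentric {s : Finset Vertex} (hs : grid.IsClique (s : Set Vertex)) {w : Vertex → ℝ}
    (hw : ∀ v ∈ s, 0 ≤ w v) (hw1 : ∑ v ∈ s, w v = 1) (v : Vertex) :
    hat v (∑ u ∈ s, w u • realPoint u) = if v ∈ s then w v else 0 := by
  have hne : s.Nonempty := by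
    rw [Finset.nonempty_iff_ne_empty]; rintro rfl; simp at hw1
  obtain ⟨a, e, he, hsub⟩ := exists_triangle_of_isClique hne hs
  -- Extending the weights by zero reduces every clique to a full triangle.
  set w' : Vertex → ℝ := fun u ↦ if u ∈ s then w u else 0 with hw'
  have hpos : ∀ u, 0 ≤ w' u := fun u ↦ by
    simp only [hw']; split_ifs with h
    exacts [hw u h, le_rfl]
  have sum_eq : ∀ f : Vertex → ℝ × ℝ, ∑ u ∈ s, w u • f u =
      ∑ u ∈ {a, a + e, a + (1, 1)}, w' u • f u := fun f ↦ by
    rw [← Finset.sum_subset hsub (fun u _ hu ↦ by simp [hw', hu])]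
    exact Finset.sum_congr rfl fun u hu ↦ by simp [hw', hu]
  have sum_one : ∑ u ∈ {a, a + e, a + (1, 1)}, w' u = 1 := by
    rw [← Finset.sum_subset hsub (fun u _ hu ↦ by simp [hw', hu]), ← hw1]
    exact Finset.sum_congr rfl fun u hu ↦ by simp [hw', hu]
  have n1 : a ∉ ({a + e, a + (1, 1)} : Finset Vertex) := by
    rcases he with rfl | rfl <;> simp
  have n2 : a + e ∉ ({a + (1, 1)} : Finset Vertex) := by
    rcases he with rfl | rfl <;> simp
  have out : ∀ u, u ≠ a → u ≠ a + e → u ≠ a + (1, 1) → w' u = 0 := fun u h1 h2 h3 ↦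
    if_neg fun hu ↦ by simpa [h1, h2, h3] using hsub hu
  rw [sum_eq, Finset.sum_insert n1, Finset.sum_insert n2, Finset.sum_singleton]
  rw [Finset.sum_insert n1, Finset.sum_insert n2, Finset.sum_singleton, ← add_assoc] at sum_one
  change _ = w' v
  have fin : (if v = a then w' a else if v = a + e then w' (a + e) else
      if v = a + (1, 1) then w' (a + (1, 1)) else 0) = w' v := by
    split_ifs with h1 h2 h3
    · rw [h1]
    · rw [h2]
    · rw [h3]
    · exact (out v h1 h2 h3).symm
  rw [← fin]
  have hp : w' a = 1 - w' (a + e) - w' (a + (1, 1)) := by linarith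
  rcases he with rfl | rfl
  · rw [← hat_lower a v (hpos _) (hpos _) (hpos _) sum_one]
    congr 1
    ext <;> simp only [realPoint, Prod.fst_add, Prod.snd_add, Prod.smul_mk, smul_eq_mul] <;>
      push_cast <;> rw [hp] <;> ring
  · rw [← hat_upper a v (hpos _) (hpos _) (hpos _) sum_one]
    congr 1
    ext <;> simp only [realPoint, Prod.fst_add, Prod.snd_add, Prod.smul_mk, smul_eq_mul] <;>
      push_cast <;> rw [hp] <;> ring

/-- The closed simplex of the plane with the given vertices. -/
def simplex (s : Finset Vertex) : Set (ℝ × ℝ) := convexHull ℝ (realPoint '' (s : Set Vertex))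

lemma exists_weights {s : Finset Vertex} {x : ℝ × ℝ} (hx : x ∈ simplex s) : ∃ w : Vertex → ℝ,
    (∀ v ∈ s, 0 ≤ w v) ∧ ∑ v ∈ s, w v = 1 ∧ ∑ v ∈ s, w v • realPoint v = x := by
  have inj : Function.Injective realPoint := fun u v h ↦ by
    simp only [realPoint, Prod.mk.injEq, Int.cast_inj] at h
    exact Prod.ext h.1 h.2
  classical
  rw [simplex, ← Finset.coe_image, Finset.mem_convexHull'] at hx
  obtain ⟨w, h0, h1, h2⟩ := hx
  rw [Finset.sum_image inj.injOn] at h1 h2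
  exact ⟨w ∘ realPoint, fun v hv ↦ h0 _ (Finset.mem_image_of_mem _ hv), h1, h2⟩

lemma hat_eq_zero {s : Finset Vertex} (hs : grid.IsClique (s : Set Vertex)) {x : ℝ × ℝ}
    (hx : x ∈ simplex s) {v : Vertex} (hv : v ∉ s) : hat v x = 0 := by
  obtain ⟨w, h0, h1, rfl⟩ := exists_weights hx
  rw [hat_barycentric hs h0 h1, if_neg hv]

lemma sum_hat {s : Finset Vertex} (hs : grid.IsClique (s : Set Vertex)) {x : ℝ × ℝ}
    (hx : x ∈ simplex s) : ∑ v ∈ s, hat v x = 1 := by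
  obtain ⟨w, h0, h1, rfl⟩ := exists_weights hx
  rw [← h1]
  exact Finset.sum_congr rfl fun v hv ↦ by rw [hat_barycentric hs h0 h1, if_pos hv]

lemma hat_realPoint (u v : Vertex) : hat v (realPoint u) = if v = u then 1 else 0 := by
  have := hat_barycentric (s := {u}) (by simp) (w := fun _ ↦ 1) (by simp) (by simp) v
  simpa using this

/-- Hats of vertices outside `t` vanish on `t`. Hence interpolations of the same vertex data from
two simplices agree where these meet. -/
lemma sum_hat_inter {s t : Finset Vertex}
    (ht : grid.IsClique (t : Set Vertex)) {x : ℝ × ℝ} (hxt : x ∈ simplex t)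
    (f : Vertex → ℝ) : ∑ v ∈ s, hat v x * f v = ∑ v ∈ s ∩ t, hat v x * f v := by
  symm
  apply Finset.sum_subset Finset.inter_subset_left
  intro v hv hv'
  rw [hat_eq_zero ht hxt (fun h ↦ hv' (Finset.mem_inter.2 ⟨hv, h⟩)), zero_mul]

/-- Two simplices of the grid that meet have a common vertex. -/
lemma inter_nonempty {s t : Finset Vertex} (hs : grid.IsClique (s : Set Vertex))
    (ht : grid.IsClique (t : Set Vertex)) {x : ℝ × ℝ} (hxs : x ∈ simplex s) (hxt : x ∈ simplex t) :
    (s ∩ t).Nonempty := by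
  rw [Finset.nonempty_iff_ne_empty]
  intro h
  have h1 := sum_hat_inter (s := s) ht hxt (fun _ ↦ 1)
  simp only [mul_one] at h1
  rw [sum_hat hs hxs, h] at h1
  simp at h1

lemma realPoint_mem_simplex {s : Finset Vertex} {v : Vertex} (hv : v ∈ s) :
    realPoint v ∈ simplex s := subset_convexHull ℝ _ ⟨v, hv, rfl⟩

lemma isClosed_simplex (s : Finset Vertex) : IsClosed (simplex s) :=
  ((s.finite_toSet.image _).isCompact_convexHull ℝ).isClosed

lemma abs_sub_le_of_mem_simplex {s : Finset Vertex} (hs : grid.IsClique (s : Set Vertex))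
    {x : ℝ × ℝ} (hx : x ∈ simplex s) {v : Vertex} (hv : v ∈ s) :
    |(v.1 : ℝ) - x.1| ≤ 1 ∧ |(v.2 : ℝ) - x.2| ≤ 1 := by
  have hsub : simplex s ⊆ Set.Icc ((v.1 : ℝ) - 1, (v.2 : ℝ) - 1) ((v.1 : ℝ) + 1, (v.2 : ℝ) + 1) := by
    refine convexHull_min ?_ (convex_Icc _ _)
    rintro _ ⟨u, hu, rfl⟩
    have h : |u.1 - v.1| ≤ 1 ∧ |u.2 - v.2| ≤ 1 := by
      by_cases h : v = u
      · simp [h]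
      · have := (grid_adj_iff v u).1 (hs hv hu h)
        exact ⟨this.2.1, this.2.2.1⟩
    simp only [abs_le] at h
    have h1 : (-1 : ℝ) ≤ u.1 - v.1 := by exact_mod_cast h.1.1
    have h2 : (u.1 : ℝ) - v.1 ≤ 1 := by exact_mod_cast h.1.2
    have h3 : (-1 : ℝ) ≤ u.2 - v.2 := by exact_mod_cast h.2.1
    have h4 : (u.2 : ℝ) - v.2 ≤ 1 := by exact_mod_cast h.2.2
    simp only [realPoint, Set.mem_Icc, Prod.mk_le_mk]
    refine ⟨⟨?_, ?_⟩, ?_, ?_⟩ <;> linarith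
  have := hsub hx
  simp only [Set.mem_Icc, Prod.le_def] at this
  simp only [abs_le]
  obtain ⟨⟨h1, h2⟩, h3, h4⟩ := this
  refine ⟨⟨?_, ?_⟩, ?_, ?_⟩ <;> linarith

/-! ### Gluing continuous functions over the simplices of a region -/

namespace Region

variable (R : Region)

lemma mem_carrier {x : ℝ × ℝ} : x ∈ R.carrier ↔ ∃ s ∈ R.faces, x ∈ simplex s := by
  simp only [carrier, Set.mem_iUnion, exists_prop]; rfl

/-- The point of the plane at a vertex of the region. -/
def point {v : Vertex} (hv : v ∈ R.vertices) : R.carrier :=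
  ⟨realPoint v, R.mem_carrier.2 ⟨{v}, hv, realPoint_mem_simplex (by simp)⟩⟩

lemma mem_faces_of_subset {s t : Finset Vertex} (hs : s ∈ R.faces) (hts : t ⊆ s)
    (ht : t.Nonempty) : t ∈ R.faces := (R.isRelLowerSet_faces hs).2 hts ht

lemma mem_vertices_of_mem {s : Finset Vertex} (hs : s ∈ R.faces) {v : Vertex} (hv : v ∈ s) :
    v ∈ R.vertices := R.mem_faces_of_subset hs (by simpa using hv) (by simp)

/-- A vertex of a simplex that meets the unit ball around `x` has coordinates within 2 of those of
`x`, which leaves finitely many vertices. Local finiteness is what allows gluing over infinite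
regions. -/
lemma locallyFinite_simplex :
    LocallyFinite fun s : R.faces ↦ {x : R.carrier | x.1 ∈ simplex s.1} := by
  intro x
  refine ⟨{y | dist y x < 1}, Metric.ball_mem_nhds x one_pos, ?_⟩
  refine Set.Finite.of_finite_image (f := Subtype.val)
    (Set.Finite.subset (Finset.finite_toSet
      (Finset.Icc (⌊x.1.1⌋ - 2, ⌊x.1.2⌋ - 2) (⌊x.1.1⌋ + 3, ⌊x.1.2⌋ + 3)).powerset) ?_)
    Subtype.val_injective.injOn
  rintro _ ⟨s, ⟨y, hys, hyx⟩, rfl⟩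
  rw [Finset.mem_coe, Finset.mem_powerset]
  intro v hv
  have h := abs_sub_le_of_mem_simplex (R.isClique_of_mem _ s.2) hys hv
  have hyx' : dist y.1 x.1 < 1 := hyx
  rw [Prod.dist_eq, max_lt_iff, Real.dist_eq, Real.dist_eq] at hyx'
  simp only [abs_le, abs_lt] at h hyx'
  have f1 := Int.floor_le x.1.1
  have f2 := Int.lt_floor_add_one x.1.1
  have f3 := Int.floor_le x.1.2
  have f4 := Int.lt_floor_add_one x.1.2
  simp only [Finset.mem_Icc, Prod.le_def]
  refine ⟨⟨?_, ?_⟩, ?_, ?_⟩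
  · have : ((⌊x.1.1⌋ - 2 : ℤ) : ℝ) ≤ v.1 := by push_cast; linarith
    exact_mod_cast this
  · have : ((⌊x.1.2⌋ - 2 : ℤ) : ℝ) ≤ v.2 := by push_cast; linarith
    exact_mod_cast this
  · have : (v.1 : ℝ) ≤ ((⌊x.1.1⌋ + 3 : ℤ) : ℝ) := by push_cast; linarith
    exact_mod_cast this
  · have : (v.2 : ℝ) ≤ ((⌊x.1.2⌋ + 3 : ℤ) : ℝ) := by push_cast; linarith
    exact_mod_cast this

/-- Continuous functions on the simplices of a region that agree where simplices meet can be glued. -/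
lemma exists_continuousMap_glue {Y : Type*} [TopologicalSpace Y] (g : Finset Vertex → ℝ × ℝ → Y)
    (hg : ∀ s ∈ R.faces, ContinuousOn (g s) (simplex s))
    (hagree : ∀ s ∈ R.faces, ∀ t ∈ R.faces, ∀ x ∈ simplex s, x ∈ simplex t → g s x = g t x) :
    ∃ f : C(R.carrier, Y), ∀ s ∈ R.faces, ∀ x : R.carrier, x.1 ∈ simplex s → f x = g s x := by
  choose S hS hxS using fun x : R.carrier ↦ R.mem_carrier.1 x.2
  have heq : ∀ s ∈ R.faces, ∀ x : R.carrier, x.1 ∈ simplex s → g (S x) x = g s x :=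
    fun s hs x hx ↦ hagree _ (hS x) _ hs _ (hxS x) hx
  refine ⟨⟨fun x ↦ g (S x) x, ?_⟩, heq⟩
  refine R.locallyFinite_simplex.continuous ?_ ?_ ?_
  · rw [Set.eq_univ_iff_forall]
    exact fun x ↦ Set.mem_iUnion.2 ⟨⟨S x, hS x⟩, hxS x⟩
  · exact fun s ↦ (isClosed_simplex s.1).preimage continuous_subtype_val
  · intro s
    refine ContinuousOn.congr (f := fun x : R.carrier ↦ g s.1 x.1) ?_ fun x hx ↦ heq s.1 s.2 x hx
    exact (hg s.1 s.2).comp continuous_subtype_val.continuousOn fun x hx ↦ hx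

/-- On a connected region, a function of the vertices that is constant on every simplex is
constant. -/
lemma eq_of_forall_face (hR : IsPreconnected R.carrier) {α : Type*} (F : Vertex → α)
    (hF : ∀ s ∈ R.faces, ∀ u ∈ s, ∀ v ∈ s, F u = F v) {u v : Vertex} (hu : u ∈ R.vertices)
    (hv : v ∈ R.vertices) : F u = F v := by
  classical
  -- For the discrete topology, constants on the simplices glue to a continuous, hence constant,
  -- function.
  let _ : TopologicalSpace α := ⊥
  have : DiscreteTopology α := ⟨rfl⟩
  have hne : ∀ s ∈ R.faces, s.Nonempty := fun s hs ↦ (R.isRelLowerSet_faces hs).1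
  obtain ⟨f, hf⟩ := R.exists_continuousMap_glue
    (fun s _ ↦ F (if h : s.Nonempty then h.choose else u)) (fun s _ ↦ continuousOn_const) (by
      intro s hs t ht x hxs hxt
      obtain ⟨w, hw⟩ := inter_nonempty (R.isClique_of_mem s hs) (R.isClique_of_mem t ht) hxs hxt
      rw [Finset.mem_inter] at hw
      rw [dif_pos (hne s hs), dif_pos (hne t ht), hF s hs _ (hne s hs).choose_spec w hw.1,
        hF t ht _ (hne t ht).choose_spec w hw.2])
  have hval : ∀ {w} (hw : w ∈ R.vertices), f (R.point hw) = F w := fun {w} hw ↦ by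
    rw [hf {w} hw _ (realPoint_mem_simplex (by simp)), dif_pos (hne _ hw)]
    exact hF {w} hw _ (hne _ hw).choose_spec w (by simp)
  have : PreconnectedSpace R.carrier := Subtype.preconnectedSpace hR
  rw [← hval hu, ← hval hv]
  exact PreconnectedSpace.constant ‹_› f.continuous

end Region

/-! ### Lifting to the line; cocycles are coboundaries -/

/-- A circle-valued function on a simply connected space has a real-valued lift whose variation along
paths is that of continuous lifts along these paths. -/
lemma exists_lift_addCircle {X : Type*} [TopologicalSpace X] [SimplyConnectedSpace X]
    (f : C(X, AddCircle (1 : ℝ))) : ∃ F : X → ℝ, (∀ x, (F x : AddCircle (1 : ℝ)) = f x) ∧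
      ∀ {x y : X} (γ : Path x y) (Γ : C(I, ℝ)), (∀ t, (Γ t : AddCircle (1 : ℝ)) = f (γ t)) →
        F y - F x = Γ 1 - Γ 0 := by
  have cov := AddCircle.isCoveringMap_coe (1 : ℝ)
  obtain ⟨x₀⟩ : Nonempty X := inferInstance
  obtain ⟨e, he⟩ := QuotientAddGroup.mk_surjective (f x₀)
  have h0 : ∀ {y} (γ : Path x₀ y), (f.comp γ.toContinuousMap) 0 = (e : AddCircle (1 : ℝ)) :=
    fun γ ↦ by simpa using he.symm
  let L {y} (γ : Path x₀ y) : C(I, ℝ) := cov.liftPath (f.comp γ.toContinuousMap) e (h0 γ)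
  have L_lift : ∀ {y} (γ : Path x₀ y) (t : I), (L γ t : AddCircle (1 : ℝ)) = f (γ t) :=
    fun γ t ↦ congr_fun (cov.liftPath_lifts (f.comp γ.toContinuousMap) e (h0 γ)) t
  have L_zero : ∀ {y} (γ : Path x₀ y), L γ 0 = e :=
    fun γ ↦ cov.liftPath_zero (f.comp γ.toContinuousMap) e (h0 γ)
  -- All paths from `x₀` to `y` are homotopic, so the end of the lift depends on `y` only.
  have L_one : ∀ {y} (γ γ' : Path x₀ y), L γ 1 = L γ' 1 := fun γ γ' ↦
    cov.liftPath_apply_one_eq_of_homotopicRel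
      ((SimplyConnectedSpace.paths_homotopic γ γ').map f) e (h0 γ) (h0 γ')
  let P (x : X) : Path x₀ x := PathConnectedSpace.somePath x₀ x
  refine ⟨fun x ↦ L (P x) 1, fun x ↦ by simpa using L_lift (P x) 1, fun {x y} γ Γ hΓ ↦ ?_⟩
  -- `Γ` and the lift along `P x` meet over the same point of the circle, so translating `Γ` by this
  -- integer makes it continue that lift. Uniqueness of lifts then identifies the concatenation.
  have hx : ((L (P x) 1 - Γ 0 : ℝ) : AddCircle (1 : ℝ)) = 0 := by
    rw [AddCircle.coe_sub, L_lift, hΓ]; simp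
  let p₁ : Path e (L (P x) 1) := ⟨L (P x), L_zero _, rfl⟩
  let p₂ : Path (L (P x) 1) (Γ 1 + (L (P x) 1 - Γ 0)) :=
    ⟨Γ + ContinuousMap.const I (L (P x) 1 - Γ 0), by simp, by simp⟩
  have key : (p₁.trans p₂).toContinuousMap = L ((P x).trans γ) := by
    refine (cov.eq_liftPath_iff' _).2 ⟨funext fun t ↦ ?_, (p₁.trans p₂).source⟩
    change (((p₁.trans p₂) t : ℝ) : AddCircle (1 : ℝ)) = f (((P x).trans γ) t)
    simp only [Path.trans_apply]
    split_ifs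
    · exact L_lift (P x) _
    · change ((Γ _ + (L (P x) 1 - Γ 0) : ℝ) : AddCircle (1 : ℝ)) = _
      rw [AddCircle.coe_add, hx, add_zero, hΓ]
  have : L (P y) 1 = Γ 1 + (L (P x) 1 - Γ 0) := by
    rw [L_one (P y) ((P x).trans γ), ← key]
    exact (p₁.trans p₂).target
  change L (P y) 1 - L (P x) 1 = _
  rw [this]; ring

/-- On a simply connected region, an integer-valued cocycle is the coboundary of a function of the
vertices. -/
lemma Region.exists_potential (R : Region) (hR : IsSimplyConnected R.carrier)
    (c : Vertex → Vertex → ℤ)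
    (hc : ∀ s ∈ R.faces, ∀ u ∈ s, ∀ v ∈ s, ∀ w ∈ s, c u v + c v w = c u w) :
    ∃ F : Vertex → ℤ, ∀ s ∈ R.faces, ∀ u ∈ s, ∀ v ∈ s, F v - F u = c u v := by
  classical
  have := hR.simplyConnectedSpace
  have hne : ∀ s ∈ R.faces, s.Nonempty := fun s hs ↦ (R.isRelLowerSet_faces hs).1
  let b (s : Finset Vertex) : Vertex := if h : s.Nonempty then h.choose else 0
  have hb : ∀ s ∈ R.faces, b s ∈ s := fun s hs ↦ by
    simp only [b, dif_pos (hne s hs)]; exact (hne s hs).choose_spec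
  -- The linear interpolation on `s` of the potential that vanishes at `u`. Another base point in
  -- `s` changes it by an integer, which is invisible in the circle.
  let g (s : Finset Vertex) (u : Vertex) (x : ℝ × ℝ) : ℝ := ∑ v ∈ s, hat v x * c u v
  have hg : ∀ s u, Continuous (g s u) := fun s u ↦
    continuous_finsetSum _ fun v _ ↦ (continuous_hat v).mul continuous_const
  have change_base : ∀ s ∈ R.faces, ∀ u ∈ s, ∀ v ∈ s, ∀ x ∈ simplex s,
      g s u x = g s v x + c u v := by
    intro s hs u hu v hv x hx
    have h1 := sum_hat (R.isClique_of_mem s hs) hx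
    simp only [g]
    rw [← one_mul (c u v : ℝ), ← h1, Finset.sum_mul, ← Finset.sum_add_distrib]
    refine Finset.sum_congr rfl fun w hw ↦ ?_
    rw [← hc s hs u hu v hv w hw]
    push_cast; ring
  have coe_base : ∀ s ∈ R.faces, ∀ u ∈ s, ∀ v ∈ s, ∀ x ∈ simplex s,
      (g s u x : AddCircle (1 : ℝ)) = g s v x := by
    intro s hs u hu v hv x hx
    rw [change_base s hs u hu v hv x hx, AddCircle.coe_add]
    have : ((c u v : ℝ) : AddCircle (1 : ℝ)) = 0 := by
      rw [AddCircle.coe_eq_zero_iff]; exact ⟨c u v, by simp⟩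
    rw [this, add_zero]
  obtain ⟨f, hf⟩ := R.exists_continuousMap_glue
    (fun s x ↦ (g s (b s) x : AddCircle (1 : ℝ)))
    (fun s _ ↦ ((AddCircle.continuous_mk' _).comp (hg s _)).continuousOn) (by
      intro s hs t ht x hxs hxt
      obtain ⟨u, hu⟩ := inter_nonempty (R.isClique_of_mem s hs) (R.isClique_of_mem t ht) hxs hxt
      have hu' := Finset.mem_inter.1 hu
      rw [coe_base s hs _ (hb s hs) u hu'.1 x hxs, coe_base t ht _ (hb t ht) u hu'.2 x hxt]
      congr 1
      simp only [g]
      -- With a common base `u`, both interpolations reduce to the vertices of `s ∩ t`.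
      rw [sum_hat_inter (R.isClique_of_mem t ht) hxt,
        sum_hat_inter (s := t) (R.isClique_of_mem s hs) hxs,
        Finset.inter_comm])
  have g_point : ∀ s, ∀ u, ∀ v ∈ s, g s u (realPoint v) = c u v := by
    intro s u v hv
    simp only [g, hat_realPoint, ite_mul, one_mul, zero_mul]
    rw [Finset.sum_ite_eq' s v, if_pos hv]
  obtain ⟨F, hF, hFΓ⟩ := exists_lift_addCircle f
  have hint : ∀ {v} (hv : v ∈ R.vertices), ∃ n : ℤ, F (R.point hv) = n := by
    -- The glued map is 0 in the circle at every vertex, because `c` takes integer values.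
    intro v hv
    have h1 := hF (R.point hv)
    rw [hf {v} hv _ (realPoint_mem_simplex (by simp)), show (R.point hv).1 = realPoint v from rfl,
      g_point {v} _ v (by simp)] at h1
    rw [← sub_eq_zero, ← AddCircle.coe_sub, AddCircle.coe_eq_zero_iff] at h1
    obtain ⟨n, hn⟩ := h1
    refine ⟨n + c (b {v}) v, ?_⟩
    push_cast
    simp at hn
    linarith
  choose N hN using @hint
  refine ⟨fun v ↦ if hv : v ∈ R.vertices then N hv else 0, fun s hs u hu v hv ↦ ?_⟩
  have hu' := R.mem_vertices_of_mem hs hu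
  have hv' := R.mem_vertices_of_mem hs hv
  simp only [dif_pos hu', dif_pos hv']
  have hseg : ∀ t : I, AffineMap.lineMap (realPoint u) (realPoint v) (t : ℝ) ∈ simplex s := by
    intro t
    apply (convex_convexHull ℝ _).segment_subset (realPoint_mem_simplex hu)
      (realPoint_mem_simplex hv)
    rw [segment_eq_image_lineMap]
    exact ⟨t, t.2, rfl⟩
  have hcont : Continuous fun t : I ↦
      (AffineMap.lineMap (realPoint u) (realPoint v) (t : ℝ) : ℝ × ℝ) :=
    AffineMap.lineMap_continuous.comp continuous_subtype_val
  let γ : Path (R.point hu') (R.point hv') :=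
    ⟨⟨fun t ↦ ⟨AffineMap.lineMap (realPoint u) (realPoint v) (t : ℝ),
      R.mem_carrier.2 ⟨s, hs, hseg t⟩⟩, hcont.subtype_mk _⟩,
      Subtype.ext (by simp [Region.point]), Subtype.ext (by simp [Region.point])⟩
  -- Along the segment from `u` to `v`, the interpolation `g s u` is itself a lift, and it varies by
  -- `c u v - c u u = c u v`.
  have h := hFΓ γ ⟨fun t ↦ g s u (γ t).1, (hg s u).comp (continuous_subtype_val.comp γ.continuous)⟩
    (fun t ↦ by
      rw [hf s hs (γ t) (hseg t)]
      exact coe_base s hs u hu _ (hb s hs) _ (hseg t))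
  simp only [ContinuousMap.coe_mk, Path.source, Path.target] at h
  rw [show (R.point hu').1 = realPoint u from rfl, show (R.point hv').1 = realPoint v from rfl,
    g_point s u v hv, g_point s u u hu, hN hu', hN hv'] at h
  have h0 := hc s hs u hu u hu u hu
  have h2 : c u u = 0 := by omega
  rw [h2] at h
  exact_mod_cast (by simpa using h : (N hv' : ℝ) - N hu' = c u v)

/-! ### Edges, triangles and lozenges -/

lemma dir_injective : Function.Injective dir := by decide

lemma dir_add_dir_add_dir (k : Fin 3) : dir k + dir (k + 1) + dir (k + 2) = 0 := by
  revert k; decide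

lemma dir_sum_eq_zero {i j k : Fin 3} (h : dir i + dir j + dir k = 0) : i ≠ j ∧ j ≠ k ∧ i ≠ k := by
  revert i j k; decide

lemma isPositive_iff (u v : Vertex) : IsPositive u v ↔
    (v.1 = u.1 + 1 ∧ v.2 = u.2) ∨ (v.1 = u.1 ∧ v.2 = u.2 + 1) ∨ (v.1 = u.1 - 1 ∧ v.2 = u.2 - 1) := by
  have h0 : dir 0 = (1, 0) := by decide
  have h1 : dir 1 = (0, 1) := by decide
  have h2 : dir 2 = (-1, -1) := by decide
  simp only [IsPositive, Fin.exists_fin_succ, Prod.ext_iff, Prod.fst_add, Prod.snd_add]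
  simp [h0, h1, h2, sub_eq_add_neg]

lemma IsPositive.ne {u v : Vertex} (h : IsPositive u v) : u ≠ v := by
  rintro rfl; rw [isPositive_iff] at h; omega

lemma IsPositive.not_symm {u v : Vertex} (h : IsPositive u v) : ¬ IsPositive v u := by
  rw [isPositive_iff] at h ⊢; omega

lemma grid_adj_iff_isPositive (u v : Vertex) : grid.Adj u v ↔ IsPositive u v ∨ IsPositive v u := by
  rw [grid, SimpleGraph.fromRel_adj]
  exact ⟨fun h ↦ h.2, fun h ↦ ⟨h.elim (fun h ↦ h.ne) (fun h ↦ h.ne.symm), h⟩⟩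

/-- An ordered pair is recovered from the set of ends of a positive edge. -/
lemma IsPositive.pair_injective {u v u' v' : Vertex} (h : IsPositive u v) (h' : IsPositive u' v')
    (he : ({u, v} : Finset Vertex) = {u', v'}) : u = u' ∧ v = v' := by
  have h1 : ({u, v} : Set Vertex) = {u', v'} := by
    simpa using congrArg (fun s : Finset Vertex ↦ (s : Set Vertex)) he
  rcases Set.pair_eq_pair_iff.1 h1 with h2 | ⟨rfl, rfl⟩
  · exact h2
  · exact (h.not_symm h').elim

/-- The positive edges of a triangle of the grid form an oriented cycle. -/
lemma IsPositive.cyclic {u v w : Vertex} (h : IsPositive u v) (huw : grid.Adj u w)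
    (hvw : grid.Adj v w) : IsPositive v w ∧ IsPositive w u := by
  rw [grid_adj_iff_isPositive] at huw hvw
  simp only [isPositive_iff] at *
  omega

/-- `u → v → w → u` are positive edges. -/
structure IsCycle (u v w : Vertex) : Prop where
  fst : IsPositive u v
  snd : IsPositive v w
  trd : IsPositive w u

lemma IsCycle.rotate {u v w : Vertex} (h : IsCycle u v w) : IsCycle v w u := ⟨h.2, h.3, h.1⟩

lemma IsCycle.dirs {u v w : Vertex} (h : IsCycle u v w) : ∃ i j k : Fin 3,
    v = u + dir i ∧ w = v + dir j ∧ u = w + dir k ∧ i ≠ j ∧ j ≠ k ∧ i ≠ k := by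
  obtain ⟨⟨i, hi⟩, ⟨j, hj⟩, ⟨k, hk⟩⟩ := h
  refine ⟨i, j, k, hi, hj, hk, dir_sum_eq_zero ?_⟩
  rw [hj, hi, add_assoc, add_assoc, left_eq_add, ← add_assoc] at hk
  exact hk

/-- The positive edges with ends in an oriented triangle. -/
lemma IsCycle.eq_of_mem {u v w x y : Vertex} (h : IsCycle u v w) (hxy : IsPositive x y)
    (hx : x ∈ ({u, v, w} : Finset Vertex)) (hy : y ∈ ({u, v, w} : Finset Vertex)) :
    (x = u ∧ y = v) ∨ (x = v ∧ y = w) ∨ (x = w ∧ y = u) := by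
  simp only [Finset.mem_insert, Finset.mem_singleton] at hx hy
  rcases hx with rfl | rfl | rfl <;> rcases hy with rfl | rfl | rfl
  · exact (hxy.ne rfl).elim
  · simp
  · exact (h.trd.not_symm hxy).elim
  · exact (h.fst.not_symm hxy).elim
  · exact (hxy.ne rfl).elim
  · simp
  · simp
  · exact (h.snd.not_symm hxy).elim
  · exact (hxy.ne rfl).elim

/-! ### Lozenges as positive edges -/

namespace Lozenge

/-- As the three directions sum to zero, the short diagonal is a positive edge from `top` to `base`
in the direction `normal`. Lozenges thus correspond to positive edges. -/
lemma base_eq (l : Lozenge) : l.base = l.top + dir l.normal := by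
  have := dir_add_dir_add_dir l.normal
  rw [top, add_assoc, add_assoc, left_eq_add, ← this]
  abel

lemma isPositive_top_base (l : Lozenge) : IsPositive l.top l.base := ⟨_, l.base_eq⟩

lemma isPositive_base_left (l : Lozenge) : IsPositive l.base l.left := ⟨_, rfl⟩

lemma isPositive_left_top (l : Lozenge) : IsPositive l.left l.top := ⟨_, rfl⟩

lemma isPositive_base_right (l : Lozenge) : IsPositive l.base l.right := ⟨_, rfl⟩

lemma isPositive_right_top (l : Lozenge) : IsPositive l.right l.top :=
  ⟨l.normal + 1, by rw [top, right]; abel⟩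

lemma isCycle_left (l : Lozenge) : IsCycle l.base l.left l.top :=
  ⟨l.isPositive_base_left, l.isPositive_left_top, l.isPositive_top_base⟩

lemma isCycle_right (l : Lozenge) : IsCycle l.base l.right l.top :=
  ⟨l.isPositive_base_right, l.isPositive_right_top, l.isPositive_top_base⟩

lemma eq_of_base_eq_of_top_eq {l l' : Lozenge} (hb : l.base = l'.base) (ht : l.top = l'.top) :
    l = l' := by
  refine Lozenge.ext hb (dir_injective ?_)
  have h := l.base_eq
  rw [hb, ht, l'.base_eq, add_right_inj] at h
  exact h.symm

lemma overlapped_eq_iff (l : Lozenge) {u v : Vertex} (h : IsPositive u v) :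
    l.overlapped = {u, v} ↔ l.top = u ∧ l.base = v := by
  constructor
  · intro he
    rw [overlapped, Finset.pair_comm] at he
    exact l.isPositive_top_base.pair_injective h he
  · rintro ⟨rfl, rfl⟩
    rw [overlapped, Finset.pair_comm]

lemma exists_of_isPositive {u v : Vertex} (h : IsPositive u v) :
    ∃ l : Lozenge, l.top = u ∧ l.base = v := by
  obtain ⟨k, rfl⟩ := h
  refine ⟨⟨u + dir k, k⟩, ?_, rfl⟩
  exact (add_right_cancel (b := dir k) (Lozenge.base_eq ⟨u + dir k, k⟩)).symm

lemma eq_left_or_right {l : Lozenge} {w : Vertex} (h : IsCycle l.top l.base w) :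
    w = l.left ∨ w = l.right := by
  obtain ⟨i, j, k, hi, rfl, -, hij, hjk, hik⟩ := h.dirs
  have : i = l.normal := by
    rw [l.base_eq, add_right_inj] at hi
    exact (dir_injective hi).symm
  subst this
  have : j = l.normal + 1 ∨ j = l.normal + 2 := by
    generalize l.normal = i at *
    clear hi h
    revert i j k; decide
  rcases this with rfl | rfl
  · exact Or.inl rfl
  · exact Or.inr rfl

lemma triangle_mem {l : Lozenge} {w : Vertex} (h : IsCycle l.top l.base w) :
    {l.top, l.base, w} ∈ l.triangles := by
  rcases eq_left_or_right h with rfl | rfl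
  · left; ext; simp; tauto
  · right; ext; simp; tauto

lemma triangles_eq_of_ne {l : Lozenge} {w w' : Vertex} (h : IsCycle l.top l.base w)
    (h' : IsCycle l.top l.base w') (hw : w ≠ w') :
    l.triangles = {{l.top, l.base, w}, {l.top, l.base, w'}} := by
  have e1 : ({l.base, l.left, l.top} : Finset Vertex) = {l.top, l.base, l.left} := by
    ext; simp; tauto
  have e2 : ({l.base, l.right, l.top} : Finset Vertex) = {l.top, l.base, l.right} := by
    ext; simp; tauto
  rw [triangles, e1, e2]
  rcases eq_left_or_right h with rfl | rfl <;> rcases eq_left_or_right h' with rfl | rfl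
  · exact (hw rfl).elim
  · rfl
  · rw [Set.pair_comm]
  · exact (hw rfl).elim

lemma left_ne_right (l : Lozenge) : l.left ≠ l.right := by
  intro h
  rw [left, right, add_right_inj] at h
  have h' := dir_injective h
  revert h'
  generalize l.normal = k
  revert k; decide

lemma top_mem {l : Lozenge} {t : Finset Vertex} (ht : t ∈ l.triangles) : l.top ∈ t := by
  rcases ht with rfl | rfl <;> simp

lemma base_mem {l : Lozenge} {t : Finset Vertex} (ht : t ∈ l.triangles) : l.base ∈ t := by
  rcases ht with rfl | rfl <;> simp

/-- A side of a lozenge lies in an oriented triangle, and the lozenge overlaps one of the other two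
edges of this triangle. -/
lemma exists_isCycle_of_mem_sides {l : Lozenge} {e : Finset Vertex} (he : e ∈ l.sides) :
    ∃ u v a, IsCycle u v a ∧ e = {u, v} ∧ {u, v, a} ∈ l.triangles ∧
      ((l.top = v ∧ l.base = a) ∨ (l.top = a ∧ l.base = u)) := by
  rcases he with rfl | rfl | rfl | rfl
  · exact ⟨_, _, _, l.isCycle_left, rfl, Or.inl rfl, Or.inr ⟨rfl, rfl⟩⟩
  · refine ⟨_, _, _, l.isCycle_left.rotate, rfl, Or.inl ?_, Or.inl ⟨rfl, rfl⟩⟩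
    ext; simp; tauto
  · exact ⟨_, _, _, l.isCycle_right, rfl, Or.inr rfl, Or.inr ⟨rfl, rfl⟩⟩
  · refine ⟨_, _, _, l.isCycle_right.rotate, rfl, Or.inr ?_, Or.inl ⟨rfl, rfl⟩⟩
    ext; simp; tauto

lemma mem_sides_of_isCycle {l : Lozenge} {u v a : Vertex} (h : IsCycle u v a)
    (hl : (l.top = v ∧ l.base = a) ∨ (l.top = a ∧ l.base = u)) : {u, v} ∈ l.sides := by
  rcases hl with ⟨rfl, rfl⟩ | ⟨rfl, rfl⟩
  · rcases eq_left_or_right h.rotate with rfl | rfl <;> simp [sides]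
  · rcases eq_left_or_right h.rotate.rotate with rfl | rfl <;> simp [sides]

end Lozenge

/-! ### Edges and triangles of a region -/

namespace Region

variable (R : Region)

lemma adj_of_mem {s : Finset Vertex} (hs : s ∈ R.faces) {u v : Vertex} (hu : u ∈ s) (hv : v ∈ s)
    (h : u ≠ v) : grid.Adj u v := R.isClique_of_mem s hs hu hv h

lemma pair_mem_edges {s : Finset Vertex} (hs : s ∈ R.faces) {u v : Vertex} (hu : u ∈ s)
    (hv : v ∈ s) (h : u ≠ v) : {u, v} ∈ R.edges :=
  ⟨R.mem_faces_of_subset hs (by intro x; simp; rintro (rfl | rfl) <;> assumption) (by simp),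
    Finset.card_pair h⟩

lemma exists_isPositive_of_mem_edges {e : Finset Vertex} (he : e ∈ R.edges) :
    ∃ u v, IsPositive u v ∧ e = {u, v} := by
  obtain ⟨u, v, huv, rfl⟩ := Finset.card_eq_two.1 he.2
  rcases (grid_adj_iff_isPositive u v).1 (R.adj_of_mem he.1 (by simp) (by simp) huv) with h | h
  · exact ⟨u, v, h, rfl⟩
  · exact ⟨v, u, h, Finset.pair_comm u v⟩

lemma left_mem_vertices {u v : Vertex} (h : {u, v} ∈ R.edges) : u ∈ R.vertices :=
  R.mem_vertices_of_mem h.1 (by simp)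

lemma right_mem_vertices {u v : Vertex} (h : {u, v} ∈ R.edges) : v ∈ R.vertices :=
  R.mem_vertices_of_mem h.1 (by simp)

/-- The third vertex of a triangle of the region with a given positive edge. -/
lemma exists_isCycle_of_mem {t : Finset Vertex} (ht : t ∈ R.triangles) {u v : Vertex}
    (h : IsPositive u v) (hu : u ∈ t) (hv : v ∈ t) : ∃ w, IsCycle u v w ∧ t = {u, v, w} := by
  have hsub : ({u, v} : Finset Vertex) ⊆ t := by
    intro x; simp; rintro (rfl | rfl) <;> assumption
  obtain ⟨w, hw, hw'⟩ : ∃ w ∈ t, w ∉ ({u, v} : Finset Vertex) := by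
    apply Finset.exists_mem_notMem_of_card_lt_card
    rw [ht.2, Finset.card_pair h.ne]; norm_num
  simp only [Finset.mem_insert, Finset.mem_singleton, not_or] at hw'
  obtain ⟨h1, h2⟩ := h.cyclic (R.adj_of_mem ht.1 hu hw (Ne.symm hw'.1))
    (R.adj_of_mem ht.1 hv hw (Ne.symm hw'.2))
  refine ⟨w, ⟨h, h1, h2⟩, (Finset.eq_of_subset_of_card_le ?_ ?_).symm⟩
  · intro x; simp; rintro (rfl | rfl | rfl) <;> assumption
  · rw [ht.2, Finset.card_eq_three.2 ⟨u, v, w, h.ne, h2.ne.symm, h1.ne, rfl⟩]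

lemma exists_isCycle {t : Finset Vertex} (ht : t ∈ R.triangles) :
    ∃ u v w, IsCycle u v w ∧ t = {u, v, w} := by
  obtain ⟨u, v, w, huv, -, -, rfl⟩ := Finset.card_eq_three.1 ht.2
  rcases (grid_adj_iff_isPositive u v).1 (R.adj_of_mem ht.1 (by simp) (by simp) huv) with h | h
  · exact ⟨u, v, R.exists_isCycle_of_mem ht h (by simp) (by simp)⟩
  · exact ⟨v, u, R.exists_isCycle_of_mem ht h (by simp) (by simp)⟩

lemma isCycle_of_mem_triangles {u v w : Vertex} (h : IsPositive u v)
    (ht : {u, v, w} ∈ R.triangles) : IsCycle u v w := by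
  obtain ⟨w', hw, heq⟩ := R.exists_isCycle_of_mem ht h (by simp) (by simp)
  have : w' ∈ ({u, v, w} : Finset Vertex) := heq ▸ by simp
  simp only [Finset.mem_insert, Finset.mem_singleton] at this
  rcases this with rfl | rfl | rfl
  exacts [(hw.trd.ne rfl).elim, (hw.snd.ne rfl).elim, hw]

lemma adj_of_mem_triangles {u v w : Vertex} (ht : {u, v, w} ∈ R.triangles) : grid.Adj u v := by
  refine R.adj_of_mem ht.1 (by simp) (by simp) ?_
  rintro rfl
  have h1 := ht.2
  rw [Finset.insert_idem] at h1
  have h2 := Finset.card_le_two (a := u) (b := w)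
  omega

lemma mem_triangles_of_mem {t : Finset Vertex} (ht : t ∈ R.triangles) {l : Lozenge}
    (h1 : l.top ∈ t) (h2 : l.base ∈ t) : t ∈ l.triangles := by
  obtain ⟨w, hw, rfl⟩ := R.exists_isCycle_of_mem ht l.isPositive_top_base h1 h2
  exact Lozenge.triangle_mem hw

lemma overlapped_mem_edges {l : Lozenge} (h : l.triangles ⊆ R.triangles) :
    {l.top, l.base} ∈ R.edges :=
  R.pair_mem_edges (h (Or.inl rfl)).1 (by simp) (by simp) l.isPositive_top_base.ne

lemma overlapped_notMem_boundary {l : Lozenge} (h : l.triangles ⊆ R.triangles) :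
    {l.top, l.base} ∉ R.boundary := by
  rintro ⟨-, h'⟩
  refine h' ⟨_, h (Or.inl rfl), _, h (Or.inr rfl), ?_, ?_, ?_⟩
  · intro he
    have : l.left ∈ ({l.base, l.right, l.top} : Finset Vertex) := he ▸ by simp
    simp only [Finset.mem_insert, Finset.mem_singleton] at this
    rcases this with h | h | h
    · exact l.isPositive_base_left.ne h.symm
    · exact l.left_ne_right h
    · exact l.isPositive_left_top.ne h
  · intro x; simp; tauto
  · intro x; simp; tauto

/-- The triangles of `R` on the two sides of an interior edge are the halves of the lozenge that
overlaps it. -/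
lemma triangles_subset_of_notMem_boundary {l : Lozenge} (he : {l.top, l.base} ∈ R.edges)
    (h : {l.top, l.base} ∉ R.boundary) : l.triangles ⊆ R.triangles := by
  obtain ⟨t, ht, t', ht', hne, hs, hs'⟩ := not_not.1 fun h' ↦ h ⟨he, h'⟩
  obtain ⟨w, hw, rfl⟩ := R.exists_isCycle_of_mem ht l.isPositive_top_base
    (hs (by simp)) (hs (by simp))
  obtain ⟨w', hw', rfl⟩ := R.exists_isCycle_of_mem ht' l.isPositive_top_base
    (hs' (by simp)) (hs' (by simp))
  rw [Lozenge.triangles_eq_of_ne hw hw' (by rintro rfl; exact hne rfl)]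
  rintro _ (rfl | rfl) <;> assumption

end Region

/-! ### From heights to tilings -/

/-- The lozenges of the region whose short diagonal is a jump of `F`. -/
def tilingOf (R : Region) (F : Vertex → ℤ) : Set Lozenge :=
  {l | l.triangles ⊆ R.triangles ∧ F l.top = F l.base + 2}

/-- The difference constraints, together with the residue condition of heights, for a function on
all vertices of the grid. -/
structure IsJumpFunction (R : Region) (X₁ X₂ : Set (Finset Vertex)) (F : Vertex → ℤ) : Prop where
  le_one : ∀ u v, IsPositive u v → {u, v} ∈ R.edges → F v - F u ≤ 1
  mod_eq : ∀ u v, IsPositive u v → {u, v} ∈ R.edges → (F v - F u) % 3 = 1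
  one_le : ∀ u v, IsPositive u v → {u, v} ∈ R.edges → {u, v} ∈ R.boundary ∪ X₁ ∪ X₂ →
    1 ≤ F v - F u
  lateral : ∀ u v a b, {u, v} ∈ X₂ → a ≠ b → {u, v, a} ∈ R.triangles →
    {u, v, b} ∈ R.triangles → F a = F b

namespace IsJumpFunction

variable {R : Region} {X₁ X₂ : Set (Finset Vertex)} {F F' : Vertex → ℤ}

/-- Exactly one edge of a triangle is a jump. -/
lemma triangle_cases (hF : IsJumpFunction R X₁ X₂ F) {u v w : Vertex} (h : IsCycle u v w)
    (ht : {u, v, w} ∈ R.triangles) :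
    (F v - F u = -2 ∧ F w - F v = 1 ∧ F u - F w = 1) ∨
    (F v - F u = 1 ∧ F w - F v = -2 ∧ F u - F w = 1) ∨
    (F v - F u = 1 ∧ F w - F v = 1 ∧ F u - F w = -2) := by
  have e1 := R.pair_mem_edges ht.1 (u := u) (v := v) (by simp) (by simp) h.fst.ne
  have e2 := R.pair_mem_edges ht.1 (u := v) (v := w) (by simp) (by simp) h.snd.ne
  have e3 := R.pair_mem_edges ht.1 (u := w) (v := u) (by simp) (by simp) h.trd.ne
  -- Three integers at most 1, congruent to 1 mod 3 and with sum zero are 1, 1, -2 in some order.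
  have := hF.le_one _ _ h.fst e1
  have := hF.le_one _ _ h.snd e2
  have := hF.le_one _ _ h.trd e3
  have := hF.mod_eq _ _ h.fst e1
  have := hF.mod_eq _ _ h.snd e2
  have := hF.mod_eq _ _ h.trd e3
  omega

/-- An interior edge lies in a triangle, which limits its increment to 1 or -2. On a boundary edge,
which may lie in no triangle, the weight -1 forces the value 1. -/
lemma edge_cases (hF : IsJumpFunction R X₁ X₂ F) (l : Lozenge) (he : {l.top, l.base} ∈ R.edges) :
    (F l.base - F l.top = 1 ∧ l ∉ tilingOf R F) ∨
    (F l.base - F l.top = -2 ∧ l ∈ tilingOf R F) := by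
  by_cases hb : {l.top, l.base} ∈ R.boundary
  · have h1 := hF.le_one _ _ l.isPositive_top_base he
    have h2 := hF.one_le _ _ l.isPositive_top_base he (Or.inl (Or.inl hb))
    exact Or.inl ⟨by omega, fun h ↦ R.overlapped_notMem_boundary h.1 hb⟩
  · have hl := R.triangles_subset_of_notMem_boundary he hb
    have ht := hl (Or.inl rfl)
    have := hF.triangle_cases l.isCycle_left ht
    rcases (by omega : F l.base - F l.top = 1 ∨ F l.base - F l.top = -2) with h | h
    · exact Or.inl ⟨h, fun h' ↦ by have := h'.2; omega⟩
    · exact Or.inr ⟨h, hl, by omega⟩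

/-- A triangle has exactly one jump edge, and a lozenge covering the triangle overlaps one of its
edges. The jump edge is interior, so its lozenge stays in `R`. -/
lemma isTiling (hF : IsJumpFunction R X₁ X₂ F) : IsTiling R (tilingOf R F) := by
  refine ⟨fun l hl ↦ hl.1, fun t ht ↦ ?_⟩
  obtain ⟨u, v, w, h, rfl⟩ := R.exists_isCycle ht
  have hcases := hF.triangle_cases h ht
  have key : ∀ x y, IsPositive x y → x ∈ ({u, v, w} : Finset Vertex) →
      y ∈ ({u, v, w} : Finset Vertex) → F y - F x = -2 →
      ∃ l ∈ tilingOf R F, {u, v, w} ∈ l.triangles := by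
    intro x y hxy hx hy hF'
    obtain ⟨l, rfl, rfl⟩ := Lozenge.exists_of_isPositive hxy
    rcases hF.edge_cases l (R.pair_mem_edges ht.1 hx hy hxy.ne) with h' | h'
    · omega
    · exact ⟨l, h'.2, R.mem_triangles_of_mem ht hx hy⟩
  refine existsUnique_of_exists_of_unique ?_ ?_
  · rcases hcases with h' | h' | h'
    · exact key u v h.fst (by simp) (by simp) h'.1
    · exact key v w h.snd (by simp) (by simp) h'.2.1
    · exact key w u h.trd (by simp) (by simp) h'.2.2
  · rintro l l' ⟨hl, htl⟩ ⟨hl', htl'⟩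
    have hd := hl.2
    have hd' := hl'.2
    have c1 := h.eq_of_mem l.isPositive_top_base (Lozenge.top_mem htl) (Lozenge.base_mem htl)
    have c2 := h.eq_of_mem l'.isPositive_top_base (Lozenge.top_mem htl') (Lozenge.base_mem htl')
    rcases c1 with ⟨h1, h2⟩ | ⟨h1, h2⟩ | ⟨h1, h2⟩ <;>
      rcases c2 with ⟨h3, h4⟩ | ⟨h3, h4⟩ | ⟨h3, h4⟩ <;>
      first
      | exact Lozenge.eq_of_base_eq_of_top_eq (h2.trans h4.symm) (h1.trans h3.symm)
      | (rw [h1, h2] at hd; rw [h3, h4] at hd'; omega)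

lemma isSolution (hF : IsJumpFunction R X₁ X₂ F) : IsSolution R X₁ X₂ (tilingOf R F) := by
  refine ⟨hF.isTiling, ?_, ?_⟩
  · rintro e he l hl rfl
    have h1 := R.overlapped_mem_edges hl.1
    have h2 := hF.one_le _ _ l.isPositive_top_base h1 (by
      rw [Finset.pair_comm, Set.union_assoc]; exact Or.inr he)
    have := hl.2
    omega
  · intro e he l hl l' hl' hne hs hs' hnormal
    obtain ⟨u, v, a, hc, rfl, ht, hcase⟩ := Lozenge.exists_isCycle_of_mem_sides hs
    obtain ⟨u', v', b, hc', heq, ht', hcase'⟩ := Lozenge.exists_isCycle_of_mem_sides hs'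
    obtain ⟨rfl, rfl⟩ := hc.fst.pair_injective hc'.fst heq
    have hab : F a = F b := by
      by_cases hab : a = b
      · rw [hab]
      · exact hF.lateral _ _ _ _ he hab (hl.1 ht) (hl'.1 ht')
    have htri := hF.triangle_cases hc (hl.1 ht)
    have hd := hl.2
    have hd' := hl'.2
    have hb := l.base_eq
    have hb' := l'.base_eq
    rw [hnormal] at hb
    -- If both short diagonals meet the edge `uv` at the same end, equal orientations make the
    -- lozenges equal. If they meet it at different ends, `F a = F b` gives `F v - F u = 4`, which
    -- no increment allows.
    rcases hcase with ⟨h1, h2⟩ | ⟨h1, h2⟩ <;> rcases hcase' with ⟨h3, h4⟩ | ⟨h3, h4⟩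
    · refine hne (Lozenge.eq_of_base_eq_of_top_eq ?_ (h1.trans h3.symm))
      rw [hb, hb', h1, h3]
    · rw [h1, h2] at hd; rw [h3, h4] at hd'; omega
    · rw [h1, h2] at hd; rw [h3, h4] at hd'; omega
    · refine hne (Lozenge.eq_of_base_eq_of_top_eq (h2.trans h4.symm) ?_)
      rw [h2] at hb; rw [h4, hb] at hb'
      exact add_right_cancel hb'

lemma mem_drawnEdges_iff (hF : IsJumpFunction R X₁ X₂ F) {u v : Vertex} (h : IsPositive u v)
    (he : {u, v} ∈ R.edges) : {u, v} ∈ drawnEdges R (tilingOf R F) ↔ |F u - F v| = 1 := by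
  obtain ⟨l, rfl, rfl⟩ := Lozenge.exists_of_isPositive h
  rcases hF.edge_cases l he with ⟨h1, h2⟩ | ⟨h1, h2⟩
  · refine iff_of_true ⟨he, fun l' hl' ho ↦ ?_⟩ ?_
    · obtain ⟨h3, h4⟩ := (l'.overlapped_eq_iff h).1 ho
      exact h2 (Lozenge.eq_of_base_eq_of_top_eq h4 h3 ▸ hl')
    · rw [abs_sub_comm, h1]; rfl
  · refine iff_of_false (fun h3 ↦ h3.2 l h2 ((l.overlapped_eq_iff h).2 ⟨rfl, rfl⟩)) ?_
    rw [abs_sub_comm, h1]; decide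

lemma linkedEdges_comp_val (hF : IsJumpFunction R X₁ X₂ F) :
    drawnEdges R (tilingOf R F) = linkedEdges R fun v ↦ F v := by
  ext e
  constructor
  · intro h
    obtain ⟨u, v, huv, rfl⟩ := R.exists_isPositive_of_mem_edges h.1
    exact ⟨h.1, ⟨u, R.left_mem_vertices h.1⟩, ⟨v, R.right_mem_vertices h.1⟩, rfl,
      (hF.mem_drawnEdges_iff huv h.1).1 h⟩
  · rintro ⟨he, u, v, rfl, habs⟩
    have hne : u.1 ≠ v.1 := fun h ↦ by simp [h] at habs
    rcases (grid_adj_iff_isPositive _ _).1 (R.adj_of_mem he.1 (by simp) (by simp) hne) with h | h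
    · exact (hF.mem_drawnEdges_iff h he).2 habs
    · rw [Finset.pair_comm] at he ⊢
      rw [abs_sub_comm] at habs
      exact (hF.mem_drawnEdges_iff h he).2 habs

/-- A tiling determines the height function up to an additive constant. -/
lemma eq_add_const (hR : IsPreconnected R.carrier) (hF : IsJumpFunction R X₁ X₂ F)
    (hF' : IsJumpFunction R X₁ X₂ F') (h : tilingOf R F = tilingOf R F') :
    ∃ c, ∀ v ∈ R.vertices, F' v = F v + c := by
  -- Membership in the tiling decides between 1 and -2, so `F` and `F'` have the same increments.
  have edge : ∀ u v, IsPositive u v → {u, v} ∈ R.edges → F' v - F v = F' u - F u := by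
    intro u v huv he
    obtain ⟨l, rfl, rfl⟩ := Lozenge.exists_of_isPositive huv
    have h1 := hF.edge_cases l he
    have h2 := hF'.edge_cases l he
    rw [← h] at h2
    rcases h1 with h1 | h1 <;> rcases h2 with h2 | h2
    · omega
    · exact (h1.2 h2.2).elim
    · exact (h2.2 h1.2).elim
    · omega
  have key := fun {u v} ↦ R.eq_of_forall_face hR (u := u) (v := v) (fun v ↦ F' v - F v) (by
    intro s hs u hu v hv
    by_cases huv : u = v
    · rw [huv]
    · rcases (grid_adj_iff_isPositive u v).1 (R.adj_of_mem hs hu hv huv) with h | h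
      · exact (edge u v h (R.pair_mem_edges hs hu hv huv)).symm
      · exact edge v u h (R.pair_mem_edges hs hv hu (Ne.symm huv)))
  by_cases hne : R.vertices.Nonempty
  · obtain ⟨u, hu⟩ := hne
    refine ⟨F' u - F u, fun v hv ↦ ?_⟩
    have := key hu hv
    omega
  · exact ⟨0, fun v hv ↦ (hne ⟨v, hv⟩).elim⟩

lemma satisfiesDC (hF : IsJumpFunction R X₁ X₂ F) : SatisfiesDC R X₁ X₂ fun v ↦ F v := by
  rintro u v w (⟨_, _, h, he⟩ | ⟨_, _, h, he, hX⟩ | ⟨x, y, _, _, he, hne, ht, ht'⟩)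
  · exact hF.le_one _ _ h he
  · rw [Finset.pair_comm] at he hX
    have := hF.one_le _ _ h he hX
    simp only
    omega
  · have := hF.lateral _ _ _ _ he (fun h ↦ hne (Subtype.ext h)) ht ht'
    simp only
    omega

/-- Along positive edges `F v` and `v.1 + v.2` change by the same amount mod 3, so by connectedness
they differ by a constant mod 3. -/
lemma isHeight (hR : IsPreconnected R.carrier) (hF : IsJumpFunction R X₁ X₂ F) :
    IsHeight R fun v ↦ F v := by
  have edge : ∀ u v, IsPositive u v → {u, v} ∈ R.edges →
      (F v - v.1 - v.2) % 3 = (F u - u.1 - u.2) % 3 := by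
    intro u v huv he
    have := hF.mod_eq u v huv he
    rw [isPositive_iff] at huv
    omega
  have key := fun {u v} ↦ R.eq_of_forall_face hR (u := u) (v := v)
    (fun v ↦ (F v - v.1 - v.2) % 3) (by
      intro s hs u hu v hv
      by_cases huv : u = v
      · rw [huv]
      · rcases (grid_adj_iff_isPositive u v).1 (R.adj_of_mem hs hu hv huv) with h | h
        · exact (edge u v h (R.pair_mem_edges hs hu hv huv)).symm
        · exact edge v u h (R.pair_mem_edges hs hv hu (Ne.symm huv)))
  by_cases hne : R.vertices.Nonempty
  · obtain ⟨u, hu⟩ := hne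
    refine ⟨F u - u.1 - u.2, fun v ↦ ?_⟩
    have := key hu v.2
    obtain ⟨m, hm⟩ : ∃ m, F v - v.1.1 - v.1.2 - (F u - u.1 - u.2) = 3 * m :=
      ⟨(F v - v.1.1 - v.1.2 - (F u - u.1 - u.2)) / 3, by omega⟩
    -- The lifts of `v` are the translates of `(v.1, v.2, 0)` by multiples of `(1, 1, 1)`, each of
    -- which adds 3 to the height.
    refine ⟨![v.1.1 + m, v.1.2 + m, m], by simp [proj], ?_⟩
    simp [height]
    omega
  · exact ⟨0, fun v ↦ (hne ⟨v, v.2⟩).elim⟩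

end IsJumpFunction

/-- The extension by zero of a function of the vertices of a region. -/
noncomputable def extend (R : Region) (h : R.vertices → ℤ) (v : Vertex) : ℤ :=
  open Classical in if hv : v ∈ R.vertices then h ⟨v, hv⟩ else 0

lemma extend_of_mem {R : Region} (h : R.vertices → ℤ) {v : Vertex} (hv : v ∈ R.vertices) :
    extend R h v = h ⟨v, hv⟩ := dif_pos hv

lemma extend_val {R : Region} (h : R.vertices → ℤ) : (fun v : R.vertices ↦ extend R h v) = h :=
  funext fun v ↦ extend_of_mem h v.2

lemma isJumpFunction_extend {R : Region} {X₁ X₂ : Set (Finset Vertex)} {h : R.vertices → ℤ}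
    (hh : IsHeight R h) (hdc : SatisfiesDC R X₁ X₂ h) : IsJumpFunction R X₁ X₂ (extend R h) := by
  obtain ⟨c, hc⟩ := hh
  refine ⟨fun u v huv he ↦ ?_, fun u v huv he ↦ ?_, fun u v huv he hX ↦ ?_,
    fun u v a b he hab ht ht' ↦ ?_⟩
  · rw [extend_of_mem h (R.left_mem_vertices he), extend_of_mem h (R.right_mem_vertices he)]
    exact hdc _ _ _ (.positive _ _ huv he)
  · rw [extend_of_mem h (R.left_mem_vertices he), extend_of_mem h (R.right_mem_vertices he)]
    obtain ⟨p, hp, hp'⟩ := hc ⟨u, R.left_mem_vertices he⟩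
    obtain ⟨q, hq, hq'⟩ := hc ⟨v, R.right_mem_vertices he⟩
    rw [hp', hq']
    subst hp hq
    rw [isPositive_iff] at huv
    simp only [proj] at huv
    simp only [height]
    omega
  · rw [extend_of_mem h (R.left_mem_vertices he), extend_of_mem h (R.right_mem_vertices he)]
    have := hdc _ _ _ (.negative ⟨v, R.right_mem_vertices he⟩ ⟨u, R.left_mem_vertices he⟩ huv
      (by rwa [Finset.pair_comm]) (by rwa [Finset.pair_comm]))
    omega
  · have ha := R.mem_vertices_of_mem ht.1 (v := a) (by simp)
    have hb := R.mem_vertices_of_mem ht'.1 (v := b) (by simp)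
    rw [extend_of_mem h ha, extend_of_mem h hb]
    have h1 := hdc ⟨a, ha⟩ ⟨b, hb⟩ 0 (.lateral u v _ _ he (by simpa using hab) ht ht')
    have h2 := hdc ⟨b, hb⟩ ⟨a, ha⟩ 0 (.lateral u v _ _ he (by simpa using hab.symm) ht' ht)
    omega

/-! ### From tilings to heights -/

/-- The increment of the height along a positive edge `u → v`. -/
noncomputable def jump (T : Set Lozenge) (u v : Vertex) : ℤ :=
  open Classical in if ∃ l ∈ T, l.top = u ∧ l.base = v then -2 else 1

/-- The increment of the height along an edge. -/
noncomputable def increment (T : Set Lozenge) (u v : Vertex) : ℤ :=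
  open Classical in
  if IsPositive u v then jump T u v else if IsPositive v u then -jump T v u else 0

lemma jump_top_base {T : Set Lozenge} {l : Lozenge} (hl : l ∈ T) : jump T l.top l.base = -2 :=
  if_pos ⟨l, hl, rfl, rfl⟩

lemma jump_eq_one_or (T : Set Lozenge) (u v : Vertex) : jump T u v = 1 ∨
    (jump T u v = -2 ∧ ∃ l ∈ T, l.top = u ∧ l.base = v) := by
  unfold jump; split_ifs with h <;> simp [h]

lemma increment_of_isPositive (T : Set Lozenge) {u v : Vertex} (h : IsPositive u v) :
    increment T u v = jump T u v := if_pos h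

lemma increment_of_isPositive' (T : Set Lozenge) {u v : Vertex} (h : IsPositive v u) :
    increment T u v = -jump T v u := by
  rw [increment, if_neg h.not_symm, if_pos h]

lemma increment_self (T : Set Lozenge) (u : Vertex) : increment T u u = 0 := by
  have : ¬ IsPositive u u := fun h ↦ h.ne rfl
  rw [increment, if_neg this, if_neg this]

lemma increment_symm (T : Set Lozenge) (u v : Vertex) : increment T v u = -increment T u v := by
  by_cases h : IsPositive u v
  · rw [increment_of_isPositive T h, increment_of_isPositive' T h]
  · by_cases h' : IsPositive v u
    · rw [increment_of_isPositive T h', increment_of_isPositive' T h', neg_neg]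
    · rw [increment, increment, if_neg h, if_neg h', if_neg h, if_neg h', neg_zero]

section

variable {R : Region} {T : Set Lozenge}

/-- The only lozenge covering the triangle overlaps one of its edges; that edge contributes -2 and
the other two contribute 1. -/
lemma IsTiling.jump_add (hT : IsTiling R T) {u v w : Vertex} (h : IsCycle u v w)
    (ht : {u, v, w} ∈ R.triangles) : jump T u v + jump T v w + jump T w u = 0 := by
  obtain ⟨l, ⟨hl, htl⟩, huniq⟩ := hT.2 _ ht
  have key : ∀ x y, IsPositive x y → x ∈ ({u, v, w} : Finset Vertex) →
      y ∈ ({u, v, w} : Finset Vertex) → ¬ (l.top = x ∧ l.base = y) → jump T x y = 1 := by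
    intro x y hxy hx hy hne
    rcases jump_eq_one_or T x y with h1 | ⟨-, l', hl', rfl, rfl⟩
    · exact h1
    · exact (hne (by rw [huniq l' ⟨hl', R.mem_triangles_of_mem ht hx hy⟩]; simp)).elim
  have hj := jump_top_base hl
  rcases h.eq_of_mem l.isPositive_top_base (Lozenge.top_mem htl) (Lozenge.base_mem htl) with
    ⟨h1, h2⟩ | ⟨h1, h2⟩ | ⟨h1, h2⟩ <;> rw [h1, h2] at hj key
  · rw [hj, key v w h.snd (by simp) (by simp) fun h' ↦ h.fst.ne h'.1,
      key w u h.trd (by simp) (by simp) fun h' ↦ h.trd.ne h'.1.symm]; rfl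
  · rw [hj, key u v h.fst (by simp) (by simp) fun h' ↦ h.fst.ne h'.1.symm,
      key w u h.trd (by simp) (by simp) fun h' ↦ h.snd.ne h'.1]; rfl
  · rw [hj, key u v h.fst (by simp) (by simp) fun h' ↦ h.trd.ne h'.1,
      key v w h.snd (by simp) (by simp) fun h' ↦ h.snd.ne h'.1.symm]; rfl

/-- This is the cocycle identity that `Region.exists_potential` requires; three distinct vertices of
a face span a triangle of `R`. -/
lemma IsTiling.increment_add (hT : IsTiling R T) {s : Finset Vertex} (hs : s ∈ R.faces)
    {u v w : Vertex} (hu : u ∈ s) (hv : v ∈ s) (hw : w ∈ s) :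
    increment T u v + increment T v w = increment T u w := by
  by_cases huv : u = v
  · rw [huv, increment_self, zero_add]
  by_cases hvw : v = w
  · rw [hvw, increment_self, add_zero]
  by_cases huw : u = w
  · rw [huw, increment_self, increment_symm T w v, add_neg_cancel]
  have ht : {u, v, w} ∈ R.triangles :=
    ⟨R.mem_faces_of_subset hs (by intro x; simp; rintro (rfl | rfl | rfl) <;> assumption)
      (by simp), Finset.card_eq_three.2 ⟨u, v, w, huv, huw, hvw, rfl⟩⟩
  rcases (grid_adj_iff_isPositive u v).1 (R.adj_of_mem hs hu hv huv) with h | h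
  · obtain ⟨h1, h2⟩ := h.cyclic (R.adj_of_mem hs hu hw huw) (R.adj_of_mem hs hv hw hvw)
    have := hT.jump_add ⟨h, h1, h2⟩ ht
    rw [increment_of_isPositive T h, increment_of_isPositive T h1, increment_of_isPositive' T h2]
    omega
  · obtain ⟨h1, h2⟩ := h.cyclic (R.adj_of_mem hs hv hw hvw) (R.adj_of_mem hs hu hw huw)
    have := hT.jump_add ⟨h, h1, h2⟩ (by rwa [Finset.insert_comm])
    rw [increment_of_isPositive' T h, increment_of_isPositive T h1, increment_of_isPositive' T h2]
    omega

variable {X₁ X₂ : Set (Finset Vertex)} {F : Vertex → ℤ}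

lemma IsSolution.isJumpFunction (hT : IsSolution R X₁ X₂ T)
    (hF : ∀ u v, IsPositive u v → {u, v} ∈ R.edges → F v - F u = jump T u v) :
    IsJumpFunction R X₁ X₂ F := by
  obtain ⟨hT1, hT2, hT3⟩ := hT
  have not_overlapped : ∀ u v, IsPositive u v → {u, v} ∈ R.boundary ∪ X₁ ∪ X₂ →
      jump T u v = 1 := by
    intro u v h hX
    rcases jump_eq_one_or T u v with h1 | ⟨-, l, hl, rfl, rfl⟩
    · exact h1
    · rw [Set.union_assoc] at hX
      rcases hX with hX | hX
      · exact (R.overlapped_notMem_boundary (hT1.1 l hl) hX).elim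
      · exact (hT2 _ hX l hl ((l.overlapped_eq_iff h).2 ⟨rfl, rfl⟩)).elim
  refine ⟨fun u v huv he ↦ ?_, fun u v huv he ↦ ?_, fun u v huv he hX ↦ ?_, ?_⟩
  · rw [hF u v huv he]
    rcases jump_eq_one_or T u v with h | ⟨h, -⟩ <;> rw [h]; norm_num
  · rw [hF u v huv he]
    rcases jump_eq_one_or T u v with h | ⟨h, -⟩ <;> rw [h] <;> rfl
  · rw [hF u v huv he, not_overlapped u v huv hX]
  -- If `F a ≠ F b`, exactly one of `va`, `vb` is a jump. Say it is `vb`: as `uv` is not overlapped,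
  -- the jump of the triangle at `a` is `au`. The two lozenges on these jumps have the side `uv`
  -- and, as shown below, the same orientation.
  · have key : ∀ u v a b, IsPositive u v → {u, v} ∈ X₂ → a ≠ b → {u, v, a} ∈ R.triangles →
        {u, v, b} ∈ R.triangles → jump T v a = 1 → jump T v b = -2 → False := by
      intro u v a b huv he hab hta htb hja hjb
      have hca := R.isCycle_of_mem_triangles huv hta
      have hcb := R.isCycle_of_mem_triangles huv htb
      have hsum := hT1.jump_add hca hta
      rw [not_overlapped u v huv (Or.inr he), hja] at hsum
      obtain ⟨l, hl, hlt, hlb⟩ : ∃ l ∈ T, l.top = a ∧ l.base = u := by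
        rcases jump_eq_one_or T a u with h | ⟨-, h⟩
        · omega
        · exact h
      obtain ⟨l', hl', hlt', hlb'⟩ : ∃ l ∈ T, l.top = v ∧ l.base = b := by
        rcases jump_eq_one_or T v b with h | ⟨-, h⟩
        · omega
        · exact h
      refine hT3 _ he l hl l' hl' ?_ (Lozenge.mem_sides_of_isCycle hca (Or.inr ⟨hlt, hlb⟩))
        (Lozenge.mem_sides_of_isCycle hcb (Or.inl ⟨hlt', hlb'⟩)) ?_
      · rintro rfl
        exact hca.snd.ne (hlt'.symm.trans hlt)
      · obtain ⟨i, j, k, hi, hj, hk, hij, hjk, hik⟩ := hca.dirs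
        obtain ⟨i', j', k', hi', hj', hk', hij', hjk', hik'⟩ := hcb.dirs
        have e1 : i = i' := dir_injective (add_left_cancel (hi.symm.trans hi'))
        have e2 : l.normal = k := by
          have := l.base_eq
          rw [hlt, hlb, hk, add_right_inj] at this
          exact (dir_injective this).symm
        have e3 : l'.normal = j' := by
          have := l'.base_eq
          rw [hlt', hlb', hj', add_right_inj] at this
          exact (dir_injective this).symm
        have e4 : j ≠ j' := by
          rintro rfl
          exact hab (hj.trans hj'.symm)
        rw [e2, e3]
        omega
    have key' : ∀ u v a b, IsPositive u v → {u, v} ∈ X₂ → a ≠ b → {u, v, a} ∈ R.triangles →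
        {u, v, b} ∈ R.triangles → F a = F b := by
      intro u v a b huv he hab hta htb
      have pos : ∀ x, {u, v, x} ∈ R.triangles → F x - F v = jump T v x := by
        intro x ht
        have hc := (R.isCycle_of_mem_triangles huv ht).snd
        exact hF v x hc (R.pair_mem_edges ht.1 (by simp) (by simp) hc.ne)
      have ha := pos a hta
      have hb := pos b htb
      rcases jump_eq_one_or T v a with h1 | ⟨h1, -⟩ <;>
        rcases jump_eq_one_or T v b with h2 | ⟨h2, -⟩
      · omega
      · exact (key u v a b huv he hab hta htb h1 h2).elim
      · exact (key u v b a huv he hab.symm htb hta h2 h1).elim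
      · omega
    intro u v a b he hab hta htb
    rcases (grid_adj_iff_isPositive u v).1 (R.adj_of_mem_triangles hta) with h | h
    · exact key' u v a b h he hab hta htb
    · rw [Finset.pair_comm] at he
      rw [Finset.insert_comm] at hta htb
      exact key' v u a b h he hab hta htb

/-- Every solution of the tiling problem comes from a height function. -/
lemma IsSolution.exists_isJumpFunction (hR : IsSimplyConnected R.carrier)
    (hT : IsSolution R X₁ X₂ T) : ∃ F, IsJumpFunction R X₁ X₂ F ∧ tilingOf R F = T := by
  obtain ⟨F, hF⟩ := R.exists_potential hR (increment T)
    fun s hs u hu v hv w hw ↦ hT.1.increment_add hs hu hv hw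
  have hF' : ∀ u v, IsPositive u v → {u, v} ∈ R.edges → F v - F u = jump T u v :=
    fun u v huv he ↦ by
      rw [hF _ he.1 u (by simp) v (by simp), increment_of_isPositive T huv]
  refine ⟨F, hT.isJumpFunction hF', ?_⟩
  ext l
  constructor
  · rintro ⟨hl, hd⟩
    have h := hF' _ _ l.isPositive_top_base (R.overlapped_mem_edges hl)
    rcases jump_eq_one_or T l.top l.base with h1 | ⟨-, l', hl', ht, hb⟩
    · omega
    · exact Lozenge.eq_of_base_eq_of_top_eq hb ht ▸ hl'
  · intro hl
    have h := hF' _ _ l.isPositive_top_base (R.overlapped_mem_edges (hT.1.1 l hl))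
    rw [jump_top_base hl] at h
    exact ⟨hT.1.1 l hl, by omega⟩

end

/-! ### Solutions of the difference constraints -/

/-- The greatest integer that is at most `n` and congruent to `r` modulo `3`. -/
def roundDown (n r : ℤ) : ℤ := r + 3 * ((n - r) / 3)

/-- A solution of the difference constraints can be rounded down to a height function. -/
lemma isHeight_roundDown (R : Region) (h : R.vertices → ℤ) :
    IsHeight R fun v ↦ roundDown (h v) (v.1.1 + v.1.2) := by
  refine ⟨0, fun v ↦ ?_⟩
  set m := (h v - (v.1.1 + v.1.2)) / 3 with hm
  refine ⟨![v.1.1 + m, v.1.2 + m, m], by simp [proj], ?_⟩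
  simp [height, roundDown, ← hm]
  ring

/-- Let `h v ≤ h u + w`, with `w` congruent mod 3 to the difference of the residues at `v` and `u`.
The rounded value at `v` minus `w` is at most `h u` and has the residue of `u`, so it is at most the
rounded value at `u`. -/
lemma SatisfiesDC.roundDown {R : Region} {X₁ X₂ : Set (Finset Vertex)} {h : R.vertices → ℤ}
    (hh : SatisfiesDC R X₁ X₂ h) :
    SatisfiesDC R X₁ X₂ fun v ↦ roundDown (h v) (v.1.1 + v.1.2) := by
  intro u v w hw
  have h1 := hh u v w hw
  have h2 : (v.1.1 + v.1.2 - (u.1.1 + u.1.2) - w) % 3 = 0 := by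
    rcases hw with ⟨_, _, h, he⟩ | ⟨_, _, h, he, hX⟩ | ⟨x, y, _, _, he, hne, ht, ht'⟩
    · rw [isPositive_iff] at h; omega
    · rw [isPositive_iff] at h; omega
    -- The vertices of a triangle have the three different residues, so two triangles on a common
    -- edge have apexes of equal residue, in accordance with the weight 0.
    · have third : ∀ x y z : Vertex, {x, y, z} ∈ R.triangles →
          (z.1 + z.2 + (x.1 + x.2 + y.1 + y.2)) % 3 = 0 := by
        intro x y z ht
        rcases (grid_adj_iff_isPositive x y).1 (R.adj_of_mem_triangles ht) with h | h
        · obtain ⟨h1, h2, -⟩ := R.isCycle_of_mem_triangles h ht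
          rw [isPositive_iff] at h1 h2
          omega
        · obtain ⟨h1, h2, -⟩ := R.isCycle_of_mem_triangles h (by rwa [Finset.insert_comm])
          rw [isPositive_iff] at h1 h2
          omega
      have := third _ _ _ ht
      have := third _ _ _ ht'
      omega
  simp only [LozengeTiling.roundDown]
  omega

end LozengeTiling

/-! ### The bijection and the solvability criterion -/

theorem theorem2 (R : LozengeTiling.Region) (hR : IsSimplyConnected R.carrier)
    (X₁ X₂ : Set (Finset LozengeTiling.Vertex))
    (hX₁ : X₁ ⊆ LozengeTiling.gridEdges) (hX₂ : X₂ ⊆ LozengeTiling.gridEdges) :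
    (∃ Φ : Quotient (LozengeTiling.heightSetoid R X₁ X₂) ≃
          {T : Set LozengeTiling.Lozenge // LozengeTiling.IsSolution R X₁ X₂ T},
        ∀ h : LozengeTiling.HeightSolution R X₁ X₂,
          LozengeTiling.drawnEdges R (Φ (Quotient.mk _ h)).1 =
            LozengeTiling.linkedEdges R h.1) ∧
    ((∃ T : Set LozengeTiling.Lozenge, LozengeTiling.IsSolution R X₁ X₂ T) ↔
      ∃ h : R.vertices → ℤ, LozengeTiling.SatisfiesDC R X₁ X₂ h) := by
  open LozengeTiling in
  have hconn : IsPreconnected R.carrier := hR.isPathConnected.isConnected.isPreconnected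
  have jump_of (h : HeightSolution R X₁ X₂) : IsJumpFunction R X₁ X₂ (extend R h.1) :=
    isJumpFunction_extend h.2.1 h.2.2
  -- The jumps depend only on differences of `h`, so the tiling is defined on classes modulo
  -- constants.
  let Ψ : Quotient (heightSetoid R X₁ X₂) → {T : Set Lozenge // IsSolution R X₁ X₂ T} :=
    Quotient.lift (fun h ↦ ⟨tilingOf R (extend R h.1), (jump_of h).isSolution⟩) (by
      rintro h h' ⟨c, hc⟩
      refine Subtype.ext (Set.ext fun l ↦ and_congr_right fun hl ↦ ?_)
      have he := R.overlapped_mem_edges hl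
      rw [extend_of_mem _ (R.left_mem_vertices he), extend_of_mem _ (R.right_mem_vertices he),
        extend_of_mem _ (R.left_mem_vertices he), extend_of_mem _ (R.right_mem_vertices he),
        hc, hc]
      omega)
  have hΨ : Function.Bijective Ψ := by
    constructor
    · rintro ⟨h⟩ ⟨h'⟩ heq
      obtain ⟨c, hc⟩ := (jump_of h).eq_add_const hconn (jump_of h') (congrArg Subtype.val heq)
      refine Quotient.sound ⟨c, fun v ↦ ?_⟩
      have := hc v v.2
      rwa [extend_of_mem _ v.2, extend_of_mem _ v.2] at this
    · rintro ⟨T, hT⟩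
      obtain ⟨F, hF, hFT⟩ := hT.exists_isJumpFunction hR
      refine ⟨Quotient.mk _ ⟨fun v ↦ F v, hF.isHeight hconn, hF.satisfiesDC⟩, Subtype.ext ?_⟩
      refine Eq.trans ?_ hFT
      refine Set.ext fun l ↦ and_congr_right fun hl ↦ ?_
      have he := R.overlapped_mem_edges hl
      rw [extend_of_mem _ (R.left_mem_vertices he), extend_of_mem _ (R.right_mem_vertices he)]
  refine ⟨⟨Equiv.ofBijective Ψ hΨ, fun h ↦ ?_⟩, ?_, ?_⟩
  · have := (jump_of h).linkedEdges_comp_val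
    rwa [extend_val] at this
  · rintro ⟨T, hT⟩
    obtain ⟨F, hF, -⟩ := hT.exists_isJumpFunction hR
    exact ⟨_, hF.satisfiesDC⟩
  · rintro ⟨h, hh⟩
    exact ⟨_, (isJumpFunction_extend (isHeight_roundDown R h) hh.roundDown).isSolution⟩
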